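/- **Setting.** Let $M$ be Minkowski spacetime: an affine space over a 4-dimensional real vector space $W$ with an inner product $\eta$ of signature $(-,+,+,+)$, an orientation and a time orientation. A vector is causal (timelike) if it is nonzero with $\eta(v,v)\le 0$ (resp. $<0$). $I^+(x)$ is the set of points reached from $x$ along future directed timelike curves; $J^+(x)$ consists of $x$ and the points reached from $x$ along future directed causal curves. Let $IL^\uparrow_+$ be the group of affine maps of $M$ whose linear part preserves $\eta$, the orientation and the time orientation. A reference frame is an origin $o\in M$ together with a positively oriented $\eta$-orthonormal base $(e_0,\dots,e_3)$ of $W$ with $e_0$ timelike future directed; it gives coordinates by $p=o+x^ae_a$. The matrix form of $P\in IL^\uparrow_+$ in the frame is the $5\times5$ matrix $\begin{pmatrix}\Lambda&-\bar b\\0&1\end{pmatrix}$ of the change of coordinates $\binom{\bar x'}{1}=\begin{pmatrix}\Lambda&-\bar b\\0&1\end{pmatrix}\binom{\bar x}{1}$ from the frame $(o,(e_a))$ to its image under $P$; a change of frame acts on it by conjugation. Let $\mathfrak{iso}(1,3)$ be the Lie algebra of the matrices $\begin{pmatrix}F&-\bar w\\0&0\end{pmatrix}$ with $\eta F+(\eta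 F)^\intercal=0$, $\eta=\mathrm{diag}(-1,1,1,1)$, and put $I_1=-\tfrac14\mathrm{Tr}\,F^2$. With $(M^{ab})^c{}_d=\eta^{ac}\delta^b_d-\eta^{bc}\delta^a_d$ and $(\bar m^a)^c=\eta^{ac}$, let $J^{ab}=\begin{pmatrix}M^{ab}&0\\0&0\end{pmatrix}$, $P^a=\begin{pmatrix}0&\bar m^a\\0&0\end{pmatrix}$, $H=P^0$, $K^2=J^{02}$, $J^1=J^{23}$, $J^3=J^{12}$. **Theorem.** Let $P\in IL^\uparrow_+$ send some point $q\in M$ into $J^+(q)\setminus\{q\}$, but no point into its chronological future. Then there is a reference frame in which $P$ takes one of the following matrix forms: $$(a)\quad \exp[(\omega J^1-\epsilon_2P^1+H)\lambda]=\exp\left(\begin{pmatrix}0&0&0&0&-1\\0&0&0&0&-\epsilon_2\\0&0&0&\omega&0\\0&0&-\omega&0&0\\0&0&0&0&0\end{pmatrix}\lambda\right)=\begin{pmatrix}1&0&0&0&-\lambda\\0&1&0&0&-\epsilon_2\lambda\\0&0&\cos(\omega\lambda)&\sin(\omega\lambda)&0\\0&0&-\sin(\omega\lambda)&\cos(\omega\lambda)&0\\0&0&0&0&1\end{pmatrix}$$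 with $\lambda>0$, $\omega>0$, $\epsilon_2=\pm1$, or $$(b)\quad \exp\{[(K^2-J^3)\eta-P^1+H]\lambda\}=\exp\left(\begin{pmatrix}0&0&-\eta&0&-1\\0&0&-\eta&0&-1\\-\eta&\eta&0&0&0\\0&0&0&0&0\\0&0&0&0&0\end{pmatrix}\lambda\right)=\begin{pmatrix}1+(\eta\lambda)^2/2&-(\eta\lambda)^2/2&-\eta\lambda&0&-\lambda\\(\eta\lambda)^2/2&1-(\eta\lambda)^2/2&-\eta\lambda&0&-\lambda\\-\eta\lambda&\eta\lambda&1&0&0\\0&0&0&1&0\\0&0&0&0&1\end{pmatrix}$$ with $\lambda>0$ and a real number $\eta\neq0$ (here $\eta$ denotes a parameter, not the inner product). Moreover, in every frame the matrix form of $P$ is the exponential of some element of $\mathfrak{iso}(1,3)$; and for every frame and every $\begin{pmatrix}F&-\bar w\\0&0\end{pmatrix}\in\mathfrak{iso}(1,3)$ whose exponential is the matrix form of $P$ in that frame, $I_1\ge0$ and: * if $I_1>0$ or $F=0$, there is $\epsilon_2\in\{1,-1\}$ such that for all $\lambda>0$ and $\omega\ge0$ with $\lambda\omega=\sqrt{2I_1}$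 there is a frame in which $P$ takes the form (a) with these $\omega,\epsilon_2,\lambda$; * if $I_1=0$ and $F\ne0$, then for all $\lambda>0$ and all $\eta\neq0$ there is a frame in which $P$ takes the form (b) with these $\eta,\lambda$. -/

import Mathlib

/-- The matrix `diag(-1, 1, 1, 1)` of the Minkowski inner product in an orthonormal frame. -/
def minkowskiEta : Matrix (Fin 4) (Fin 4) ℝ := Matrix.diagonal ![-1, 1, 1, 1]

/-- The structure `(η, or, ↑)` on a real vector space `W` making it a Minkowski vector space:
an inner product of signature `(-,+,+,+)` (so `W` is 4-dimensional), an orientation, and a time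
orientation, i.e. the choice of one of the two timelike cones as the future one. -/
structure MinkowskiStructure (W : Type*) [AddCommGroup W] [Module ℝ W] where
  form : LinearMap.BilinForm ℝ W
  signature : ∃ e : Module.Basis (Fin 4) ℝ W, ∀ a b, form (e a) (e b) = minkowskiEta a b
  orientation : Orientation ℝ W (Fin 4)
  future : Set W
  future_cone : ∃ u, form u u < 0 ∧ future = {w | form w w < 0 ∧ form u w < 0}

namespace MinkowskiStructure

variable {W : Type*} [AddCommGroup W] [Module ℝ W] (S : MinkowskiStructure W)

/-- Future directed timelike vectors. -/
def FutureTimelike (w : W) : Prop := w ∈ S.future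

/-- Future directed causal vectors: nonzero, nonspacelike, and on the future side. -/
def FutureCausal (w : W) : Prop :=
  w ≠ 0 ∧ S.form w w ≤ 0 ∧ ∀ u ∈ S.future, S.form u w < 0

/-- The proper orthochronous Lorentz group: linear automorphisms of `W` that preserve the inner
product and the orientation and send the future timelike cone into itself. -/
structure IsLorentz (L : W ≃ₗ[ℝ] W) : Prop where
  form_eq : ∀ v w, S.form (L v) (L w) = S.form v w
  orientation_eq : Orientation.map (Fin 4) L S.orientation = S.orientation
  future_mem : ∀ w ∈ S.future, L w ∈ S.future

variable {M : Type*} [AddTorsor W M]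

/-- The inhomogeneous proper orthochronous Lorentz group of the spacetime `M`: the affine maps
whose linear part is a proper orthochronous Lorentz transformation. -/
def IsPoincare (P : M ≃ᵃ[ℝ] M) : Prop := S.IsLorentz P.linear

/-- `γ`, restricted to `[0,1]`, is a continuously differentiable curve in `M` with velocity `v`.
(As `W` is finite-dimensional, derivatives and continuity are tested on linear functionals.) -/
def IsC1Curve (γ : ℝ → M) (v : ℝ → W) : Prop :=
  ∀ f : Module.Dual ℝ W,
    ContinuousOn (fun t => f (v t)) (Set.Icc 0 1) ∧
    ∀ t ∈ Set.Icc (0 : ℝ) 1,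
      HasDerivWithinAt (fun s => f (γ s -ᵥ γ 0)) (f (v t)) (Set.Icc 0 1) t

/-- The chronological future `I⁺(x)`: points reached from `x` along a future directed timelike
curve. -/
def chronologicalFuture (x : M) : Set M :=
  {y | ∃ (γ : ℝ → M) (v : ℝ → W), IsC1Curve γ v ∧ γ 0 = x ∧ γ 1 = y ∧
    ∀ t ∈ Set.Icc (0 : ℝ) 1, S.FutureTimelike (v t)}

/-- The causal future `J⁺(x)`: the point `x` together with the points reached from `x` along a
future directed causal curve. -/
def causalFuture (x : M) : Set M :=
  {y | y = x ∨ ∃ (γ : ℝ → M) (v : ℝ → W), IsC1Curve γ v ∧ γ 0 = x ∧ γ 1 = y ∧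
    ∀ t ∈ Set.Icc (0 : ℝ) 1, S.FutureCausal (v t)}

/-- A reference frame on `M`: an origin and a proper orthochronous orthonormal base of `W`. -/
structure Frame (M : Type*) [AddTorsor W M] where
  origin : M
  basis : Module.Basis (Fin 4) ℝ W
  orthonormal : ∀ a b, S.form (basis a) (basis b) = minkowskiEta a b
  oriented : basis.orientation = S.orientation
  future_mem : basis 0 ∈ S.future

variable {S}

namespace Frame

/-- The coordinates `x^a` of a point: `p = o + x^a e_a`. -/
noncomputable def coord (fr : S.Frame M) (p : M) : Fin 4 → ℝ :=
  fr.basis.repr (p -ᵥ fr.origin)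

/-- The image `(P(o), {Λ(e_a)})` of a frame under a Poincaré transformation. -/
noncomputable def map (fr : S.Frame M) (P : M ≃ᵃ[ℝ] M) (hP : S.IsPoincare P) : S.Frame M where
  origin := P fr.origin
  basis := fr.basis.map P.linear
  orthonormal a b := by
    rw [Module.Basis.map_apply, Module.Basis.map_apply, hP.form_eq, fr.orthonormal]
  oriented := by
    rw [Module.Basis.orientation_map, fr.oriented]
    exact hP.orientation_eq
  future_mem := by
    rw [Module.Basis.map_apply]
    exact hP.future_mem _ fr.future_mem

end Frame

end MinkowskiStructure

/-- The vector `(x, 1)`. -/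
def homogeneous (x : Fin 4 → ℝ) : Fin 5 → ℝ := ![x 0, x 1, x 2, x 3, 1]

/-- The `5 × 5` matrix with rows `(F, v)` and `(0, s)`. -/
def augmented (F : Matrix (Fin 4) (Fin 4) ℝ) (v : Fin 4 → ℝ) (s : ℝ) :
    Matrix (Fin 5) (Fin 5) ℝ :=
  !![F 0 0, F 0 1, F 0 2, F 0 3, v 0;
     F 1 0, F 1 1, F 1 2, F 1 3, v 1;
     F 2 0, F 2 1, F 2 2, F 2 3, v 2;
     F 3 0, F 3 1, F 3 2, F 3 3, v 3;
     0, 0, 0, 0, s]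

/-- In the coordinates of the frame `fr`, the Poincaré transformation `P` takes the matrix form
`G`: this is the matrix of the change of coordinates `(x', 1) = G (x, 1)` from the frame `fr`
to its image under `P`. -/
def HasMatrixForm {W M : Type*} [AddCommGroup W] [Module ℝ W] [AddTorsor W M]
    {S : MinkowskiStructure W} (fr : S.Frame M) (P : M ≃ᵃ[ℝ] M) (hP : S.IsPoincare P)
    (G : Matrix (Fin 5) (Fin 5) ℝ) : Prop :=
  ∀ p : M, G.mulVec (homogeneous (fr.coord p)) = homogeneous ((fr.map P hP).coord p)

/-- Membership in `so(1,3)`: `F_{ab} + F_{ba} = 0` after lowering the index with `η`. -/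
def IsSO13 (F : Matrix (Fin 4) (Fin 4) ℝ) : Prop :=
  minkowskiEta * F + (minkowskiEta * F).transpose = 0

/-- The invariant `I₁ = (1/4) F_{ab} F^{ab} = -(1/4) Tr F²`. -/
noncomputable def invariantI1 (F : Matrix (Fin 4) (Fin 4) ℝ) : ℝ :=
  -(1 / 4) * (F * F).trace

/-- The generator `J^{ab}`, with `(M^{ab})^c_d = η^{ac} δ^b_d - η^{bc} δ^a_d`. -/
noncomputable def genLorentz (a b : Fin 4) : Matrix (Fin 5) (Fin 5) ℝ :=
  augmented (Matrix.of fun c d =>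
    minkowskiEta a c * (1 : Matrix (Fin 4) (Fin 4) ℝ) b d
      - minkowskiEta b c * (1 : Matrix (Fin 4) (Fin 4) ℝ) a d) 0 0

/-- The generator `P^a`, with `(m^a)^c = η^{ac}`. -/
noncomputable def genTranslation (a : Fin 4) : Matrix (Fin 5) (Fin 5) ℝ :=
  augmented 0 (fun c => minkowskiEta a c) 0

/-- `H = P^0`. -/
noncomputable def genH : Matrix (Fin 5) (Fin 5) ℝ := genTranslation 0

/-- `P^1`. -/
noncomputable def genP1 : Matrix (Fin 5) (Fin 5) ℝ := genTranslation 1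

/-- `J^1 = J^{23}`. -/
noncomputable def genJ1 : Matrix (Fin 5) (Fin 5) ℝ := genLorentz 2 3

/-- `J^3 = J^{12}`. -/
noncomputable def genJ3 : Matrix (Fin 5) (Fin 5) ℝ := genLorentz 1 2

/-- `K^2 = J^{02}`. -/
noncomputable def genK2 : Matrix (Fin 5) (Fin 5) ℝ := genLorentz 0 2

/-- In the frame `fr`, `P` takes the form `exp[(ω J^1 - ε P^1 + H) lam]`, displayed through the
generators, through the exponent as an explicit matrix, and as an explicit matrix. -/
def IsLightlikeScrewForm {W M : Type*} [AddCommGroup W] [Module ℝ W] [AddTorsor W M]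
    {S : MinkowskiStructure W} (fr : S.Frame M) (P : M ≃ᵃ[ℝ] M) (hP : S.IsPoincare P)
    (ω ε lam : ℝ) : Prop :=
  HasMatrixForm fr P hP (NormedSpace.exp (lam • (ω • genJ1 - ε • genP1 + genH))) ∧
  NormedSpace.exp (lam • (ω • genJ1 - ε • genP1 + genH)) =
    NormedSpace.exp (lam •
      !![0, 0, 0, 0, -1;
         0, 0, 0, 0, -ε;
         0, 0, 0, ω, 0;
         0, 0, -ω, 0, 0;
         0, 0, 0, 0, 0]) ∧
  NormedSpace.exp (lam • (ω • genJ1 - ε • genP1 + genH)) =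
    !![1, 0, 0, 0, -lam;
       0, 1, 0, 0, -ε * lam;
       0, 0, Real.cos (ω * lam), Real.sin (ω * lam), 0;
       0, 0, -Real.sin (ω * lam), Real.cos (ω * lam), 0;
       0, 0, 0, 0, 1]

/-- In the frame `fr`, `P` takes the form `exp{[(K^2 - J^3) κ - P^1 + H] lam}`, displayed through
the generators, through the exponent as an explicit matrix, and as an explicit matrix. -/
def IsNullRotationForm {W M : Type*} [AddCommGroup W] [Module ℝ W] [AddTorsor W M]
    {S : MinkowskiStructure W} (fr : S.Frame M) (P : M ≃ᵃ[ℝ] M) (hP : S.IsPoincare P)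
    (κ lam : ℝ) : Prop :=
  HasMatrixForm fr P hP (NormedSpace.exp (lam • (κ • (genK2 - genJ3) - genP1 + genH))) ∧
  NormedSpace.exp (lam • (κ • (genK2 - genJ3) - genP1 + genH)) =
    NormedSpace.exp (lam •
      !![0, 0, -κ, 0, -1;
         0, 0, -κ, 0, -1;
         -κ, κ, 0, 0, 0;
         0, 0, 0, 0, 0;
         0, 0, 0, 0, 0]) ∧
  NormedSpace.exp (lam • (κ • (genK2 - genJ3) - genP1 + genH)) =
    !![1 + (κ * lam) ^ 2 / 2, -((κ * lam) ^ 2 / 2), -(κ * lam), 0, -lam;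
       (κ * lam) ^ 2 / 2, 1 - (κ * lam) ^ 2 / 2, -(κ * lam), 0, -lam;
       -(κ * lam), κ * lam, 1, 0, 0;
       0, 0, 0, 1, 0;
       0, 0, 0, 0, 1]

/-! The matrix form of `P` in a frame is the matrix of `P⁻¹` in the coordinates of that frame. The
displacement from `q` to `P q` is causal and not timelike, hence null, and a frame with origin `P q`
can be chosen in which it is k = e_0 + e_1. The form is then x ↦ Λ x - k, and the displacements of
`P` over all of `M` are the vectors k + (1 - Λ) x. They fill an affine subspace through k, a
boundary point of the future cone, and this subspace misses the open cone. So the range of 1 - Λ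
lies in the tangent hyperplane, which is the orthogonal complement of k
(`eq_of_forall_not_timelike`). As Λ is an isometry, this means that Λ fixes k.

The stabilizer of a null vector in the proper orthochronous Lorentz group is the group of Euclidean
motions of a plane: null rotations play the translations, and rotations about e_1 the rotations
(`eq_nullRotationMatrix_mul_rotationMatrix`). A plane motion with a nontrivial rotation has a fixed
point, hence is conjugate to a rotation. What remains is the identity or a pure null rotation. All
these conjugations fix k and leave the translation part alone, which gives the two families
(`exists_normal_form`). Boosts along e_1, a half turn, and in case (b) a shift of the origin then
adjust the parameters.

For an arbitrary logarithm, conjugation moves it to the adapted frame while preserving `invariantI1`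
and the vanishing of F (`HasMatrixForm.exp_conj`). There exp F is a rotation or a nontrivial null
rotation. Since F commutes with exp F, its shape is determined, except when exp F = 1, where
eigenvalues are used instead. The rotation case gives I₁ > 0 or F = 0, with √(2 I₁) the rotation
angle up to sign and period. The null case gives I₁ = 0 and F ≠ 0. -/

open scoped Matrix

/-! ### Closed forms of exponentials -/

section Exponential

variable {𝔸 : Type*} [NormedRing 𝔸] [NormedAlgebra ℝ 𝔸] [CompleteSpace 𝔸]

/-- Uniqueness for the linear equation E' = X E: the product exp(-tX) E(t) has zero derivative. -/
theorem exp_eq_of_hasDerivAt {X : 𝔸} {E : ℝ → 𝔸} (h : ∀ t, HasDerivAt E (X * E t) t)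
    (h0 : E 0 = 1) : NormedSpace.exp X = E 1 := by
  let _ : NormedAlgebra ℚ 𝔸 := NormedAlgebra.restrictScalars ℚ ℝ 𝔸
  have hd : ∀ t : ℝ, HasDerivAt (fun t => NormedSpace.exp (t • -X) * E t) 0 t := by
    intro t
    refine ((hasDerivAt_exp_smul_const (-X) t).mul (h t)).congr_deriv ?_
    noncomm_ring
  have hc := is_const_of_deriv_eq_zero (fun t => (hd t).differentiableAt)
    (fun t => (hd t).deriv) 1 0
  simp only [one_smul, zero_smul, NormedSpace.exp_zero, h0, mul_one] at hc
  have hi : NormedSpace.exp X * NormedSpace.exp (-X) = 1 := by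
    rw [← NormedSpace.exp_add_of_commute (Commute.refl X).neg_right, add_neg_cancel,
      NormedSpace.exp_zero]
  calc NormedSpace.exp X = NormedSpace.exp X * (NormedSpace.exp (-X) * E 1) := by rw [hc, mul_one]
    _ = E 1 := by rw [← mul_assoc, hi, one_mul]

/-- Rodrigues' formula, with an extra square-zero summand `B` that annihilates `J` on both sides;
the right-hand side, with `θ` and `B` scaled by t, solves the differential equation. For the screw
motion `B` is the translation part. -/
theorem exp_rotation_add_translation {B J : 𝔸} (hJ : J * J * J = -J) (hBJ : B * J = 0)
    (hJB : J * B = 0) (hBB : B * B = 0) (θ : ℝ) :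
    NormedSpace.exp (θ • J + B) =
      1 + B + Real.sin θ • J + (1 - Real.cos θ) • (J * J) := by
  have key := exp_eq_of_hasDerivAt (X := θ • J + B)
    (E := fun t : ℝ => 1 + t • B + Real.sin (t * θ) • J + (1 - Real.cos (t * θ)) • (J * J)) ?_ ?_
  · simpa using key
  · intro t
    have hm : HasDerivAt (fun t : ℝ => t * θ) θ t := hasDerivAt_mul_const θ
    have hs := (hm.sin).smul_const J
    have hc := ((hm.cos).const_sub 1).smul_const (J * J)
    have hB := (hasDerivAt_id t).smul_const B
    refine (((hB.const_add 1).add hs).add hc).congr_deriv ?_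
    simp only [add_mul, mul_add, smul_mul_assoc, mul_smul_comm, mul_one, hBJ, hJB, hBB, zero_mul,
      smul_zero, ← mul_assoc, hJ]
    module
  · simp

theorem exp_of_cube_eq_zero {X : 𝔸} (hX : X * X * X = 0) :
    NormedSpace.exp X = 1 + X + (1 / 2 : ℝ) • (X * X) := by
  have key := exp_eq_of_hasDerivAt (X := X)
    (E := fun t : ℝ => 1 + t • X + (t ^ 2 / 2) • (X * X)) ?_ ?_
  · simpa using key
  · intro t
    have h2 : HasDerivAt (fun t : ℝ => t ^ 2 / 2) t t := by
      refine ((hasDerivAt_pow 2 t).div_const 2).congr_deriv ?_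
      push_cast; ring
    refine ((((hasDerivAt_id t).smul_const X).const_add 1).add (h2.smul_const (X * X))).congr_deriv ?_
    simp only [mul_add, mul_smul_comm, mul_one, ← mul_assoc, hX, smul_zero]
    module
  · simp

end Exponential

namespace Matrix

variable {m n : Type*} [Fintype m] [DecidableEq m] [Fintype n] [DecidableEq n]

theorem exp_rotation_add_translation {B J : Matrix n n ℝ} (hJ : J * J * J = -J) (hBJ : B * J = 0)
    (hJB : J * B = 0) (hBB : B * B = 0) (θ : ℝ) :
    NormedSpace.exp (θ • J + B) =
      1 + B + Real.sin θ • J + (1 - Real.cos θ) • (J * J) := by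
  let : NormedRing (Matrix n n ℝ) := Matrix.linftyOpNormedRing
  let : NormedAlgebra ℝ (Matrix n n ℝ) := Matrix.linftyOpNormedAlgebra
  exact _root_.exp_rotation_add_translation hJ hBJ hJB hBB θ

theorem exp_of_cube_eq_zero {X : Matrix n n ℝ} (hX : X * X * X = 0) :
    NormedSpace.exp X = 1 + X + (1 / 2 : ℝ) • (X * X) := by
  let : NormedRing (Matrix n n ℝ) := Matrix.linftyOpNormedRing
  let : NormedAlgebra ℝ (Matrix n n ℝ) := Matrix.linftyOpNormedAlgebra
  exact _root_.exp_of_cube_eq_zero hX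

theorem hasSum_exp (A : Matrix n n ℝ) :
    HasSum (fun k : ℕ => ((k.factorial : ℝ)⁻¹) • A ^ k) (NormedSpace.exp A) := by
  let : NormedRing (Matrix n n ℝ) := Matrix.linftyOpNormedRing
  let : NormedAlgebra ℝ (Matrix n n ℝ) := Matrix.linftyOpNormedAlgebra
  exact NormedSpace.exp_series_hasSum_exp' A

/-- The relation passes to powers and then to the exponential series. A rectangular `V` covers both
eigenvectors and the inclusion of an invariant subspace. -/
theorem exp_mul_of_intertwine {A : Matrix m m ℝ} {B : Matrix n n ℝ} {V : Matrix m n ℝ}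
    (h : A * V = V * B) : NormedSpace.exp A * V = V * NormedSpace.exp B := by
  have hp : ∀ k : ℕ, A ^ k * V = V * B ^ k := by
    intro k
    induction k with
    | zero => simp
    | succ k ih => rw [pow_succ, Matrix.mul_assoc, h, ← Matrix.mul_assoc, ih, Matrix.mul_assoc,
        ← pow_succ]
  have h1 := (hasSum_exp A).map (Matrix.addMonoidHomMulRight V) (by
    change Continuous fun X : Matrix m m ℝ => X * V
    fun_prop)
  have h2 := (hasSum_exp B).map (Matrix.addMonoidHomMulLeft V) (by
    change Continuous fun X : Matrix n n ℝ => V * X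
    fun_prop)
  have he : (fun k : ℕ => ((k.factorial : ℝ)⁻¹ • A ^ k) * V) =
      fun k : ℕ => V * ((k.factorial : ℝ)⁻¹ • B ^ k) := by
    funext k
    simp [hp]
  change HasSum (fun k : ℕ => ((k.factorial : ℝ)⁻¹ • A ^ k) * V) (NormedSpace.exp A * V) at h1
  rw [he] at h1
  exact h1.unique h2

theorem exp_mulVec_of_eigenvector {A : Matrix n n ℝ} {v : n → ℝ} {μ : ℝ} (h : A *ᵥ v = μ • v) :
    NormedSpace.exp A *ᵥ v = Real.exp μ • v := by
  have h1 := exp_mul_of_intertwine (A := A) (B := diagonal fun _ : Unit => μ)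
    (V := replicateCol Unit v) (by
      ext i j
      have := congrFun h i
      simpa [Matrix.mul_diagonal, mul_apply, mulVec, dotProduct, mul_comm] using this)
  rw [exp_diagonal] at h1
  ext i
  have := congrFun (congrFun h1 i) ()
  rw [Matrix.mul_diagonal] at this
  have he : (NormedSpace.exp fun _ : Unit => μ) () = Real.exp μ := by
    rw [Pi.coe_exp, Real.exp_eq_exp_ℝ]
  rw [he] at this
  simpa [mul_apply, mulVec, dotProduct, mul_comm] using this

end Matrix

/-! ### Affine maps as 5 × 5 matrices -/

section Augmented

open Matrix

theorem augmented_mul (A B : Matrix (Fin 4) (Fin 4) ℝ) (v w : Fin 4 → ℝ) (s t : ℝ) :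
    augmented A v s * augmented B w t = augmented (A * B) (A *ᵥ w + t • v) (s * t) := by
  ext i j
  fin_cases i <;> fin_cases j <;>
    simp [augmented, Matrix.mul_apply, Matrix.mulVec, dotProduct, Fin.sum_univ_succ] <;> ring

theorem augmented_mulVec_homogeneous (A : Matrix (Fin 4) (Fin 4) ℝ) (v x : Fin 4 → ℝ) :
    augmented A v 1 *ᵥ homogeneous x = homogeneous (A *ᵥ x + v) := by
  ext i
  fin_cases i <;>
    simp [augmented, homogeneous, Matrix.mulVec, dotProduct, Fin.sum_univ_succ] <;> ring

theorem homogeneous_injective : Function.Injective homogeneous := by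
  intro x y h
  ext i
  have := congrFun h i.castSucc
  fin_cases i <;> simpa [homogeneous] using this

/-- The vectors (x, 1) span: x = 0 gives the last column, and the standard basis vectors then give
the others. -/
theorem ext_of_mulVec_homogeneous {A B : Matrix (Fin 5) (Fin 5) ℝ}
    (h : ∀ x, A *ᵥ homogeneous x = B *ᵥ homogeneous x) : A = B := by
  have h4 : ∀ i, A i 4 = B i 4 := by
    intro i
    have := congrFun (h 0) i
    simpa [homogeneous, Matrix.mulVec, dotProduct, Fin.sum_univ_succ] using this
  ext i j
  refine Fin.lastCases (h4 i) (fun k => ?_) j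
  have h1 := congrFun (h (Pi.single k 1)) i
  have h2 := h4 i
  fin_cases k <;>
    simp [homogeneous, Matrix.mulVec, dotProduct, Fin.sum_univ_succ] at h1 ⊢ <;>
    change A i 4 = B i 4 at h2 <;> simp_all

/-- The vectors with last coordinate 0 form an invariant subspace on which an augmented matrix acts
by its linear part; `V` below is the inclusion. -/
theorem exp_augmented (F : Matrix (Fin 4) (Fin 4) ℝ) (v : Fin 4 → ℝ)
    {Λ : Matrix (Fin 4) (Fin 4) ℝ} {b : Fin 4 → ℝ}
    (h : NormedSpace.exp (augmented F v 0) = augmented Λ b 1) : NormedSpace.exp F = Λ := by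
  let V : Matrix (Fin 5) (Fin 4) ℝ := Matrix.of fun i j => if i = j.castSucc then 1 else 0
  have hV : ∀ (A : Matrix (Fin 4) (Fin 4) ℝ) (w : Fin 4 → ℝ) (s : ℝ),
      augmented A w s * V = V * A := by
    intro A w s
    ext i j
    fin_cases i <;> fin_cases j <;>
      simp [V, augmented, Matrix.mul_apply, Fin.sum_univ_succ]
  have h1 := Matrix.exp_mul_of_intertwine (hV F v 0)
  rw [h, hV] at h1
  have hVV : Vᵀ * V = 1 := by
    ext i j
    fin_cases i <;> fin_cases j <;> simp [V, Matrix.mul_apply]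
  calc NormedSpace.exp F = Vᵀ * (V * NormedSpace.exp F) := by
        rw [← Matrix.mul_assoc, hVV, Matrix.one_mul]
    _ = Λ := by rw [← h1, ← Matrix.mul_assoc, hVV, Matrix.one_mul]

end Augmented

/-- The proper orthochronous Lorentz matrices. -/
structure IsLorentzMatrix (Λ : Matrix (Fin 4) (Fin 4) ℝ) : Prop where
  isometry : Λᵀ * minkowskiEta * Λ = minkowskiEta
  det_eq_one : Λ.det = 1
  orthochronous : 0 < Λ 0 0

/-- Cauchy–Schwarz for the spatial parts, with the spatial norms strictly below the time components.
-/
theorem inner_lt_of_timelike {x y : Fin 4 → ℝ} (hx : x 1 ^ 2 + x 2 ^ 2 + x 3 ^ 2 < x 0 ^ 2)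
    (hx0 : 0 < x 0) (hy : y 1 ^ 2 + y 2 ^ 2 + y 3 ^ 2 < y 0 ^ 2) (hy0 : 0 < y 0) :
    x 1 * y 1 + x 2 * y 2 + x 3 * y 3 < x 0 * y 0 := by
  refine lt_of_pow_lt_pow_left₀ 2 (by positivity) ?_
  have h1 : (x 1 * y 1 + x 2 * y 2 + x 3 * y 3) ^ 2 ≤
      (x 1 ^ 2 + x 2 ^ 2 + x 3 ^ 2) * (y 1 ^ 2 + y 2 ^ 2 + y 3 ^ 2) := by
    nlinarith [sq_nonneg (x 1 * y 2 - x 2 * y 1), sq_nonneg (x 1 * y 3 - x 3 * y 1),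
      sq_nonneg (x 2 * y 3 - x 3 * y 2)]
  have h2 : (x 1 ^ 2 + x 2 ^ 2 + x 3 ^ 2) * (y 1 ^ 2 + y 2 ^ 2 + y 3 ^ 2) <
      x 0 ^ 2 * y 0 ^ 2 := by
    apply mul_lt_mul'' hx hy <;> positivity
  rw [mul_pow]
  exact h1.trans_lt h2

/-! ### Frames and changes of coordinates -/

namespace MinkowskiStructure

variable {W : Type*} [AddCommGroup W] [Module ℝ W] {S : MinkowskiStructure W}

section Basis

variable {e : Module.Basis (Fin 4) ℝ W} (he : ∀ a b, S.form (e a) (e b) = minkowskiEta a b)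
include he

theorem form_eq_repr (v w : W) :
    S.form v w = -(e.repr v 0 * e.repr w 0) + e.repr v 1 * e.repr w 1
      + e.repr v 2 * e.repr w 2 + e.repr v 3 * e.repr w 3 := by
  conv_lhs => rw [← e.sum_repr v, ← e.sum_repr w]
  simp only [Fin.sum_univ_four, map_add, map_smul, LinearMap.add_apply, LinearMap.smul_apply, he,
    smul_eq_mul]
  simp [minkowskiEta]
  ring

theorem mem_future_iff_repr (h0 : e 0 ∈ S.future) (w : W) :
    w ∈ S.future ↔ e.repr w 1 ^ 2 + e.repr w 2 ^ 2 + e.repr w 3 ^ 2 < e.repr w 0 ^ 2 ∧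
      0 < e.repr w 0 := by
  obtain ⟨u, hu, hF⟩ := S.future_cone
  rw [hF] at h0 ⊢
  have hu0 : 0 < e.repr u 0 := by
    have := h0.2
    rw [form_eq_repr he] at this
    simpa [Finsupp.single_apply] using this
  rw [form_eq_repr he] at hu
  have hu' : e.repr u 1 ^ 2 + e.repr u 2 ^ 2 + e.repr u 3 ^ 2 < e.repr u 0 ^ 2 := by linarith
  simp only [Set.mem_ofPred_eq]
  rw [form_eq_repr he, form_eq_repr he]
  constructor
  · rintro ⟨h1, h2⟩
    have h1' : e.repr w 1 ^ 2 + e.repr w 2 ^ 2 + e.repr w 3 ^ 2 < e.repr w 0 ^ 2 := by linarith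
    refine ⟨h1', ?_⟩
    by_contra hneg
    have hne : e.repr w 0 ≠ 0 := by
      intro h
      rw [h] at h1'
      nlinarith [sq_nonneg (e.repr w 1), sq_nonneg (e.repr w 2), sq_nonneg (e.repr w 3)]
    have hlt : 0 < -e.repr w 0 := by
      rcases lt_or_gt_of_ne hne with h | h <;> linarith
    -- If w were past directed, -w would be future directed, and the form of u with w would be
    -- positive.
    have := inner_lt_of_timelike (x := e.repr u) (y := fun i => -e.repr w i) hu' hu0
      (by simpa using h1') hlt
    linarith
  · rintro ⟨h1, h2⟩
    have := inner_lt_of_timelike hu' hu0 h1 h2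
    exact ⟨by linarith, by linarith⟩

end Basis

namespace Frame

variable {M : Type*} [AddTorsor W M]

theorem isLorentzMatrix_toMatrix (fr fr' : S.Frame M) :
    IsLorentzMatrix (fr'.basis.toMatrix fr.basis) := by
  have hi : (fr'.basis.toMatrix fr.basis)ᵀ * minkowskiEta * fr'.basis.toMatrix fr.basis =
      minkowskiEta := by
    ext a b
    rw [← fr.orthonormal a b, form_eq_repr fr'.orthonormal]
    simp [minkowskiEta, Matrix.mul_apply, Fin.sum_univ_succ, Matrix.diagonal_apply,
      Module.Basis.toMatrix_apply]
    ring
  refine ⟨hi, ?_, ?_⟩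
  · have hpos : 0 < (fr'.basis.toMatrix fr.basis).det := by
      rw [← Module.Basis.det_apply, ← Module.Basis.orientation_eq_iff_det_pos, fr.oriented,
        fr'.oriented]
    have hd := congrArg Matrix.det hi
    have he : minkowskiEta.det = -1 := by simp [minkowskiEta, Fin.prod_univ_succ]
    rw [Matrix.det_mul, Matrix.det_mul, Matrix.det_transpose, he] at hd
    nlinarith
  · exact ((mem_future_iff_repr fr'.orthonormal fr'.future_mem _).1 fr.future_mem).2

/-- The matrix of the change of coordinates from `fr` to `fr'`. -/
noncomputable def transition (fr fr' : S.Frame M) : Matrix (Fin 5) (Fin 5) ℝ :=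
  augmented (fr'.basis.toMatrix fr.basis) (fr'.coord fr.origin) 1

theorem transition_mulVec (fr fr' : S.Frame M) (p : M) :
    fr.transition fr' *ᵥ homogeneous (fr.coord p) = homogeneous (fr'.coord p) := by
  rw [transition, augmented_mulVec_homogeneous]
  congr 1
  rw [coord, Module.Basis.toMatrix_mulVec_repr]
  ext i
  simp only [coord, Pi.add_apply]
  rw [← Finsupp.add_apply, ← map_add, vsub_add_vsub_cancel]

theorem exists_coord_eq (fr : S.Frame M) (x : Fin 4 → ℝ) : ∃ p : M, fr.coord p = x := by
  refine ⟨fr.basis.equivFun.symm x +ᵥ fr.origin, ?_⟩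
  rw [coord, vadd_vsub]
  exact fr.basis.equivFun.apply_symm_apply x

theorem ext_of_mulVec_coord (fr : S.Frame M) {A B : Matrix (Fin 5) (Fin 5) ℝ}
    (h : ∀ p, A *ᵥ homogeneous (fr.coord p) = B *ᵥ homogeneous (fr.coord p)) : A = B := by
  refine ext_of_mulVec_homogeneous fun x => ?_
  obtain ⟨p, rfl⟩ := fr.exists_coord_eq x
  exact h p

theorem transition_mul_transition (fr₁ fr₂ fr₃ : S.Frame M) :
    fr₂.transition fr₃ * fr₁.transition fr₂ = fr₁.transition fr₃ := by
  refine fr₁.ext_of_mulVec_coord fun p => ?_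
  rw [← Matrix.mulVec_mulVec, transition_mulVec, transition_mulVec, transition_mulVec]

theorem transition_self (fr : S.Frame M) : fr.transition fr = 1 :=
  fr.ext_of_mulVec_coord fun p => by rw [transition_mulVec, Matrix.one_mulVec]

theorem coord_map (fr : S.Frame M) (P : M ≃ᵃ[ℝ] M) (hP : S.IsPoincare P) (p : M) :
    (fr.map P hP).coord (P p) = fr.coord p := by
  have h : P p -ᵥ P fr.origin = P.linear (p -ᵥ fr.origin) :=
    (P.toAffineMap.linearMap_vsub p fr.origin).symm
  simp [coord, map, h]

/-- `P` carries both frames along, so their relative position is unchanged. This is what makes a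
change of frame act on matrix forms by conjugation. -/
theorem transition_map_map (fr fr' : S.Frame M) (P : M ≃ᵃ[ℝ] M) (hP : S.IsPoincare P) :
    (fr.map P hP).transition (fr'.map P hP) = fr.transition fr' := by
  refine fr.ext_of_mulVec_coord fun p => ?_
  rw [transition_mulVec, ← fr.coord_map P hP, transition_mulVec, coord_map]

theorem _root_.hasMatrixForm_iff {fr : S.Frame M} {P : M ≃ᵃ[ℝ] M} {hP : S.IsPoincare P}
    {G : Matrix (Fin 5) (Fin 5) ℝ} :
    HasMatrixForm fr P hP G ↔ G = fr.transition (fr.map P hP) := by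
  constructor
  · intro h
    exact fr.ext_of_mulVec_coord fun p => by rw [h p, transition_mulVec]
  · rintro rfl p
    exact transition_mulVec _ _ _

theorem _root_.HasMatrixForm.conj {fr : S.Frame M} {P : M ≃ᵃ[ℝ] M} {hP : S.IsPoincare P}
    {G : Matrix (Fin 5) (Fin 5) ℝ} (h : HasMatrixForm fr P hP G) (fr' : S.Frame M) :
    HasMatrixForm fr' P hP (fr.transition fr' * G * fr'.transition fr) := by
  rw [hasMatrixForm_iff] at h ⊢
  rw [h, ← transition_map_map fr fr' P hP, transition_mul_transition, transition_mul_transition]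

/-- The frame with origin at `b` and base `Λ^c_a e_c` in terms of the frame `fr`. -/
noncomputable def transform (fr : S.Frame M) (Λ : Matrix (Fin 4) (Fin 4) ℝ)
    (hΛ : IsLorentzMatrix Λ) (b : Fin 4 → ℝ) : S.Frame M where
  origin := fr.basis.equivFun.symm b +ᵥ fr.origin
  basis := fr.basis.map (Matrix.toLinearEquiv fr.basis Λ (by rw [hΛ.det_eq_one]; exact isUnit_one))
  orthonormal a b := by
    rw [form_eq_repr fr.orthonormal, ← hΛ.isometry]
    simp [Matrix.toLin_self, minkowskiEta, Matrix.mul_apply, Fin.sum_univ_succ,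
      Matrix.diagonal_apply]
    ring
  oriented := by
    rw [← fr.oriented, eq_comm, Module.Basis.orientation_eq_iff_det_pos, Module.Basis.det_apply]
    have : fr.basis.toMatrix (fr.basis.map (Matrix.toLinearEquiv fr.basis Λ
        (by rw [hΛ.det_eq_one]; exact isUnit_one))) = Λ := by
      ext i j
      fin_cases i <;>
      simp [Module.Basis.toMatrix_apply, Matrix.toLin_self, Fin.sum_univ_succ]
    rw [this, hΛ.det_eq_one]
    exact one_pos
  future_mem := by
    rw [mem_future_iff_repr fr.orthonormal fr.future_mem]
    have h := congrFun (congrFun hΛ.isometry 0) 0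
    simp [minkowskiEta, Matrix.mul_apply, Fin.sum_univ_succ, Matrix.diagonal_apply] at h
    have h0 := hΛ.orthochronous
    simp [Matrix.toLin_self, Fin.sum_univ_succ]
    exact ⟨by linarith, h0⟩

theorem transform_transition (fr : S.Frame M) (Λ : Matrix (Fin 4) (Fin 4) ℝ)
    (hΛ : IsLorentzMatrix Λ) (b : Fin 4 → ℝ) :
    (fr.transform Λ hΛ b).transition fr = augmented Λ b 1 := by
  have h1 : fr.basis.toMatrix (fr.transform Λ hΛ b).basis = Λ := by
    ext i j
    fin_cases i <;>
      simp [Module.Basis.toMatrix_apply, transform, Matrix.toLin_self, Fin.sum_univ_succ]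
  have h2 : fr.coord (fr.transform Λ hΛ b).origin = b := by
    simp only [coord, transform, vadd_vsub]
    exact fr.basis.equivFun.apply_symm_apply b
  rw [transition, h1, h2]

/-- The two equations are the blocks of G T = T G' with T the transition matrix, so a normal form
can be checked without computing T⁻¹. -/
theorem _root_.HasMatrixForm.transform {fr : S.Frame M} {P : M ≃ᵃ[ℝ] M} {hP : S.IsPoincare P}
    {A A' : Matrix (Fin 4) (Fin 4) ℝ} {v v' : Fin 4 → ℝ}
    (h : HasMatrixForm fr P hP (augmented A v 1)) {Λ : Matrix (Fin 4) (Fin 4) ℝ}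
    (hΛ : IsLorentzMatrix Λ) (b : Fin 4 → ℝ) (hA : A * Λ = Λ * A')
    (hv : A *ᵥ b + v = Λ *ᵥ v' + b) :
    HasMatrixForm (fr.transform Λ hΛ b) P hP (augmented A' v' 1) := by
  have h1 := h.conj (fr.transform Λ hΛ b)
  convert h1 using 1
  have h2 : augmented A v 1 * augmented Λ b 1 = augmented Λ b 1 * augmented A' v' 1 := by
    rw [augmented_mul, augmented_mul, hA, one_smul, one_smul, hv]
  rw [transform_transition, Matrix.mul_assoc, h2, ← Matrix.mul_assoc, ← transform_transition fr Λ hΛ b,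
    transition_mul_transition, transition_self, Matrix.one_mul]

/-- Frames with a given origin exist. -/
theorem _root_.MinkowskiStructure.exists_frame (S : MinkowskiStructure W) (o : M) :
    ∃ fr : S.Frame M, fr.origin = o := by
  obtain ⟨e, he⟩ := S.signature
  obtain ⟨u, hu, hF⟩ := S.future_cone
  -- Sign changes keep orthonormality: negating e_0 repairs the time orientation, after which
  -- negating e_1 repairs the orientation without touching e_0.
  have hflip : ∀ (f : Module.Basis (Fin 4) ℝ W) (i : Fin 4),
      (∀ a b, S.form (f a) (f b) = minkowskiEta a b) →
      ∀ a b, S.form (f.unitsSMul (Function.update 1 i (-1)) a)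
        (f.unitsSMul (Function.update 1 i (-1)) b) = minkowskiEta a b := by
    intro f i hf a b
    fin_cases i <;> fin_cases a <;> fin_cases b <;>
      simp [Module.Basis.unitsSMul_apply, hf, minkowskiEta]
  have hfut : ∃ f : Module.Basis (Fin 4) ℝ W,
      (∀ a b, S.form (f a) (f b) = minkowskiEta a b) ∧ f 0 ∈ S.future := by
    have hne : S.form u (e 0) ≠ 0 := by
      intro h
      rw [form_eq_repr he] at h hu
      simp at h
      rw [h] at hu
      nlinarith [sq_nonneg (e.repr u 1), sq_nonneg (e.repr u 2), sq_nonneg (e.repr u 3)]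
    rcases lt_or_gt_of_ne hne with h | h
    · refine ⟨e, he, ?_⟩
      rw [hF]
      exact ⟨by rw [he]; simp [minkowskiEta], h⟩
    · refine ⟨_, hflip e 0 he, ?_⟩
      rw [hF]
      refine ⟨by rw [hflip e 0 he]; simp [minkowskiEta], ?_⟩
      simpa [Module.Basis.unitsSMul_apply] using h
  obtain ⟨f, hf, hf0⟩ := hfut
  rcases f.orientation_eq_or_eq_neg S.orientation with h | h
  · exact ⟨⟨o, f, hf, h.symm, hf0⟩, rfl⟩
  · refine ⟨⟨o, _, hflip f 1 hf, ?_, ?_⟩, rfl⟩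
    · rw [Module.Basis.orientation_neg_single, h]
    · simpa [Module.Basis.unitsSMul_apply] using hf0

end Frame

end MinkowskiStructure

/-! ### Null displacements and the adapted frame -/

/-- A line through k = (1, 1, 0, 0) that misses the open future cone is tangent to it. To first
order in t, the form of k + t w with itself is -2t (w 0 - w 1). -/
theorem eq_of_forall_not_timelike {w : Fin 4 → ℝ}
    (h : ∀ t : ℝ, ¬((t * w 1 + 1) ^ 2 + (t * w 2) ^ 2 + (t * w 3) ^ 2 < (t * w 0 + 1) ^ 2 ∧
      0 < t * w 0 + 1)) : w 0 = w 1 := by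
  by_contra hne
  have hd : 0 < (w 0 - w 1) ^ 2 := by
    have := sub_ne_zero.2 hne
    positivity
  obtain ⟨N, hN⟩ : ∃ N, N = 1 + w 0 ^ 2 + w 1 ^ 2 + w 2 ^ 2 + w 3 ^ 2 + (w 0 - w 1) ^ 2 := ⟨_, rfl⟩
  have hN0 : 0 < N := by rw [hN]; positivity
  have key : 0 < 2 * N + (w 0 ^ 2 - w 1 ^ 2 - w 2 ^ 2 - w 3 ^ 2) := by
    rw [hN]; nlinarith [sq_nonneg (w 0), sq_nonneg (w 1), sq_nonneg (w 2), sq_nonneg (w 3)]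
  -- The sign of t makes the first-order term negative, and `N` is large enough to dominate the
  -- quadratic term and keep the time component positive.
  refine h ((w 0 - w 1) / N) ⟨?_, ?_⟩
  · have : ((w 0 - w 1) / N * w 0 + 1) ^ 2 - (((w 0 - w 1) / N * w 1 + 1) ^ 2
        + ((w 0 - w 1) / N * w 2) ^ 2 + ((w 0 - w 1) / N * w 3) ^ 2) =
        (w 0 - w 1) ^ 2 / N ^ 2 * (2 * N + (w 0 ^ 2 - w 1 ^ 2 - w 2 ^ 2 - w 3 ^ 2)) := by
      field_simp
      ring
    have h2 : 0 < (w 0 - w 1) ^ 2 / N ^ 2 * (2 * N + (w 0 ^ 2 - w 1 ^ 2 - w 2 ^ 2 - w 3 ^ 2)) := by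
      positivity
    linarith
  · have : (w 0 - w 1) / N * w 0 + 1 = ((w 0 - w 1) * w 0 + N) / N := by field_simp
    rw [this]
    apply div_pos _ hN0
    rw [hN]
    nlinarith [sq_nonneg (w 0 - w 1 + w 0), sq_nonneg (w 2), sq_nonneg (w 3), sq_nonneg (w 1)]

theorem exists_unit_orthogonal (a b c : ℝ) :
    ∃ x y z : ℝ, x ^ 2 + y ^ 2 + z ^ 2 = 1 ∧ a * x + b * y + c * z = 0 := by
  rcases eq_or_ne (b ^ 2 + c ^ 2) 0 with h0 | h0
  · exact ⟨0, 1, 0, by norm_num, by nlinarith [sq_nonneg b, sq_nonneg c]⟩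
  · have hr : √(b ^ 2 + c ^ 2) ^ 2 = b ^ 2 + c ^ 2 := Real.sq_sqrt (by positivity)
    have hr0 : √(b ^ 2 + c ^ 2) ≠ 0 := by
      intro h; rw [h] at hr; exact h0 (by rw [← hr]; ring)
    refine ⟨0, c / √(b ^ 2 + c ^ 2), -b / √(b ^ 2 + c ^ 2), ?_, ?_⟩
    · field_simp
      rw [hr]; ring
    · field_simp
      ring

/-- Every future directed null vector is the image of `(1, 1, 0, 0)`. -/
theorem exists_isLorentzMatrix_mulVec {x : Fin 4 → ℝ} (h0 : 0 < x 0)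
    (h : x 1 ^ 2 + x 2 ^ 2 + x 3 ^ 2 = x 0 ^ 2) :
    ∃ T, IsLorentzMatrix T ∧ T *ᵥ ![1, 1, 0, 0] = x := by
  obtain ⟨s, hs⟩ : ∃ s, s = x 0 := ⟨_, rfl⟩
  obtain ⟨a, ha⟩ : ∃ a, a = x 1 / s := ⟨_, rfl⟩
  obtain ⟨b, hb⟩ : ∃ b, b = x 2 / s := ⟨_, rfl⟩
  obtain ⟨c, hc⟩ : ∃ c, c = x 3 / s := ⟨_, rfl⟩
  have hs0 : s ≠ 0 := by rw [hs]; exact h0.ne'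
  have habc : a ^ 2 + b ^ 2 + c ^ 2 = 1 := by
    rw [ha, hb, hc]; field_simp; rw [h, hs]
  obtain ⟨m, y, z, hm, hn⟩ := exists_unit_orthogonal a b c
  obtain ⟨C, hC⟩ : ∃ C, C = (s + s⁻¹) / 2 := ⟨_, rfl⟩
  obtain ⟨D, hD⟩ : ∃ D, D = (s - s⁻¹) / 2 := ⟨_, rfl⟩
  -- `C` and `D` are the hyperbolic cosine and sine of log s. The matrix below is the boost along
  -- e_1 taking k to s k, followed by the rotation taking e_1, e_2, e_3 to n = (a, b, c), the unit
  -- normal (m, y, z), and their cross product.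
  have hCD : C ^ 2 - D ^ 2 = 1 := by rw [hC, hD]; field_simp; ring
  have hCD' : C + D = s := by rw [hC, hD]; ring
  have hcr : (b * z - c * y) ^ 2 + (c * m - a * z) ^ 2 + (a * y - b * m) ^ 2 = 1 := by
    linear_combination (m ^ 2 + y ^ 2 + z ^ 2) * habc + hm - (a * m + b * y + c * z) * hn
  refine ⟨!![C, D, 0, 0; D * a, C * a, m, b * z - c * y; D * b, C * b, y, c * m - a * z;
    D * c, C * c, z, a * y - b * m], ⟨?_, ?_, ?_⟩, ?_⟩
  · ext i j
    fin_cases i <;> fin_cases j <;>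
      simp [minkowskiEta, Matrix.mul_apply, Fin.sum_univ_succ, Matrix.diagonal_apply] <;> grind
  · simp [Matrix.det_succ_row_zero, Fin.sum_univ_succ, Fin.succAbove]
    linear_combination hCD +
      (C ^ 2 - D ^ 2) * hcr
  · simp only [hC, Matrix.of_apply, Matrix.cons_val_zero]
    rw [hs]; positivity
  · ext i
    fin_cases i
    · simp [Matrix.mulVec, dotProduct, Fin.sum_univ_succ, hCD', hs]
    · have : D * a + C * a = x 1 := by
        rw [← add_mul, add_comm, hCD', ha]; field_simp
      simpa [Matrix.mulVec, dotProduct, Fin.sum_univ_succ] using this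
    · have : D * b + C * b = x 2 := by
        rw [← add_mul, add_comm, hCD', hb]; field_simp
      simpa [Matrix.mulVec, dotProduct, Fin.sum_univ_succ] using this
    · have : D * c + C * c = x 3 := by
        rw [← add_mul, add_comm, hCD', hc]; field_simp
      simpa [Matrix.mulVec, dotProduct, Fin.sum_univ_succ] using this

namespace MinkowskiStructure

variable {W M : Type*} [AddCommGroup W] [Module ℝ W] [AddTorsor W M] {S : MinkowskiStructure W}

/-- The straight segment is a timelike curve. -/
theorem mem_chronologicalFuture {x y : M} (h : y -ᵥ x ∈ S.future) :
    y ∈ S.chronologicalFuture x := by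
  refine ⟨fun t => t • (y -ᵥ x) +ᵥ x, fun _ => y -ᵥ x, fun f => ⟨continuousOn_const, ?_⟩,
    by simp, by simp, fun _ _ => h⟩
  intro t _
  simpa using ((hasDerivAt_id t).mul_const (f (y -ᵥ x))).hasDerivWithinAt

/-- By the mean value theorem, the pairing of u with the total displacement equals its pairing with
some velocity of the curve. -/
theorem form_lt_zero_of_mem_causalFuture {x y : M} (h : y ∈ S.causalFuture x) (hne : y ≠ x)
    {u : W} (hu : u ∈ S.future) : S.form u (y -ᵥ x) < 0 := by
  rcases h with h | ⟨γ, v, hγ, h0, h1, hv⟩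
  · exact absurd h hne
  obtain ⟨-, hd⟩ := hγ (S.form u)
  obtain ⟨c, hc, hs⟩ := exists_hasDerivAt_eq_slope (fun s => S.form u (γ s -ᵥ γ 0))
    (fun t => S.form u (v t)) one_pos (fun t ht => (hd t ht).continuousWithinAt)
    (fun t ht => (hd t (Set.Ioo_subset_Icc_self ht)).hasDerivAt (Icc_mem_nhds ht.1 ht.2))
  have := (hv c (Set.Ioo_subset_Icc_self hc)).2.2 u hu
  simp only [vsub_self, map_zero, sub_zero, div_one, h0, h1] at hs
  rwa [hs] at this

theorem Frame.repr_vsub (fr : S.Frame M) (p q : M) (i : Fin 4) :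
    fr.basis.repr (p -ᵥ q) i = fr.coord p i - fr.coord q i := by
  rw [← vsub_sub_vsub_cancel_right p q fr.origin, map_sub]
  rfl

theorem exists_adapted_frame {P : M ≃ᵃ[ℝ] M} (hP : S.IsPoincare P)
    (hJ : ∃ q : M, P q ∈ S.causalFuture q \ {q})
    (hI : ∀ q : M, P q ∉ S.chronologicalFuture q) :
    ∃ (fr : S.Frame M) (Λ : Matrix (Fin 4) (Fin 4) ℝ), IsLorentzMatrix Λ ∧
      (∀ j, (1 : Matrix (Fin 4) (Fin 4) ℝ) 0 j - Λ 0 j = (1 : Matrix (Fin 4) (Fin 4) ℝ) 1 j - Λ 1 j)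
      ∧ HasMatrixForm fr P hP (augmented Λ ![-1, -1, 0, 0] 1) := by
  obtain ⟨q, hq, hne⟩ := hJ
  obtain ⟨fr₀, ho⟩ := S.exists_frame (P q)
  obtain ⟨x, hx⟩ : ∃ x : Fin 4 → ℝ, x = fr₀.basis.repr (P q -ᵥ q) := ⟨_, rfl⟩
  have hform : ∀ u ∈ S.future, S.form u (P q -ᵥ q) < 0 := fun u hu =>
    form_lt_zero_of_mem_causalFuture hq (by simpa using hne) hu
  have hx0 : 0 < x 0 := by
    have := hform _ fr₀.future_mem
    rw [form_eq_repr fr₀.orthonormal, ← hx] at this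
    simpa using this
  have hnull : x 1 ^ 2 + x 2 ^ 2 + x 3 ^ 2 = x 0 ^ 2 := by
    apply le_antisymm
    · by_contra! hlt
      -- If the displacement x were spacelike, this vector would be future timelike and orthogonal
      -- to it.
      obtain ⟨u, hu⟩ := fr₀.basis.equivFun.surjective
        ![x 1 ^ 2 + x 2 ^ 2 + x 3 ^ 2, x 0 * x 1, x 0 * x 2, x 0 * x 3]
      have hu' : ∀ i, fr₀.basis.repr u i = ![x 1 ^ 2 + x 2 ^ 2 + x 3 ^ 2, x 0 * x 1, x 0 * x 2,
        x 0 * x 3] i := fun i => congrFun hu i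
      have hpos : 0 < x 1 ^ 2 + x 2 ^ 2 + x 3 ^ 2 := lt_trans (by positivity) hlt
      have hf := hform u (by
        rw [mem_future_iff_repr fr₀.orthonormal fr₀.future_mem]
        simp only [hu', Matrix.cons_val]
        exact ⟨by nlinarith, hpos⟩)
      rw [form_eq_repr fr₀.orthonormal, ← hx] at hf
      simp only [hu', Matrix.cons_val] at hf
      nlinarith
    · by_contra! hlt
      apply hI q
      apply mem_chronologicalFuture
      rw [mem_future_iff_repr fr₀.orthonormal fr₀.future_mem, ← hx]
      exact ⟨hlt, hx0⟩
  obtain ⟨T, hT, hTx⟩ := exists_isLorentzMatrix_mulVec hx0 hnull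
  let fr := fr₀.transform T hT 0
  have hor : fr.origin = P q := by simp [fr, Frame.transform, ho]
  have hq' : fr.coord q = ![-1, -1, 0, 0] := by
    have h1 := fr.transition_mulVec fr₀ q
    rw [Frame.transform_transition, augmented_mulVec_homogeneous] at h1
    have h2 := homogeneous_injective h1
    have h3 : fr₀.coord q = -x := by
      rw [hx, ← neg_vsub_eq_vsub_rev, ← ho, map_neg]
      ext i; simp [Frame.coord]
    have h4 : T *ᵥ (fr.coord q) = T *ᵥ ![-1, -1, 0, 0] := by
      rw [add_zero] at h2
      rw [h2, h3, ← hTx, ← Matrix.mulVec_neg]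
      simp
    exact Matrix.mulVec_injective_of_isUnit
      ((Matrix.isUnit_iff_isUnit_det T).2 (by rw [hT.det_eq_one]; exact isUnit_one)) h4
  have hG : HasMatrixForm fr P hP (augmented ((fr.map P hP).basis.toMatrix fr.basis)
      ![-1, -1, 0, 0] 1) := by
    rw [hasMatrixForm_iff, Frame.transition, hor, Frame.coord_map, hq']
  refine ⟨fr, _, Frame.isLorentzMatrix_toMatrix _ _, fun j => ?_, hG⟩
  generalize (fr.map P hP).basis.toMatrix fr.basis = Λ at hG
  have key : (fun i => (1 : Matrix (Fin 4) (Fin 4) ℝ) i j - Λ i j) 0 =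
      (fun i => (1 : Matrix (Fin 4) (Fin 4) ℝ) i j - Λ i j) 1 := by
    refine eq_of_forall_not_timelike
      (w := fun i => (1 : Matrix (Fin 4) (Fin 4) ℝ) i j - Λ i j) fun t ht => ?_
    -- The point of coordinates t e_j is reached by `P` with displacement k + t w, where w is the
    -- j-th column of 1 - Λ.
    obtain ⟨p, hp⟩ := fr.exists_coord_eq (Pi.single j t)
    apply hI (P.symm p)
    apply mem_chronologicalFuture
    have h1 := hG p
    rw [augmented_mulVec_homogeneous] at h1
    have h2 := homogeneous_injective h1
    have h3 : fr.coord (P.symm p) = Λ *ᵥ (Pi.single j t) + ![-1, -1, 0, 0] := by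
      rw [← hp, h2, ← fr.coord_map P hP, P.apply_symm_apply]
    have h4 : ∀ i, (Pi.single j t : Fin 4 → ℝ) i = t * (1 : Matrix (Fin 4) (Fin 4) ℝ) i j := by
      intro i
      simp [Pi.single_apply, Matrix.one_apply]
    rw [P.apply_symm_apply, mem_future_iff_repr fr.orthonormal fr.future_mem]
    simp only [Frame.repr_vsub, h3, hp, h4, Pi.add_apply, Matrix.mulVec_single, Matrix.col_apply,
      Pi.smul_apply, MulOpposite.smul_eq_mul_unop, MulOpposite.unop_op, Matrix.cons_val]
    constructor
    · convert ht.1 using 1 <;> ring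
    · convert ht.2 using 1; ring
  exact key

end MinkowskiStructure

/-! ### The stabilizer of a null vector -/

/-- The Lorentz matrix acting on the plane of `e_2, e_3` by the rows `(A, B)` and `(-B, A)`. -/
def rotationMatrix (A B : ℝ) : Matrix (Fin 4) (Fin 4) ℝ :=
  !![1, 0, 0, 0; 0, 1, 0, 0; 0, 0, A, B; 0, 0, -B, A]

/-- The null rotations fixing `e_0 + e_1`. -/
noncomputable def nullRotationMatrix (u v : ℝ) : Matrix (Fin 4) (Fin 4) ℝ :=
  !![1 + (u ^ 2 + v ^ 2) / 2, -((u ^ 2 + v ^ 2) / 2), u, v;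
     (u ^ 2 + v ^ 2) / 2, 1 - (u ^ 2 + v ^ 2) / 2, u, v;
     u, -u, 1, 0; v, -v, 0, 1]

/-- The boost that multiplies `e_0 + e_1` by `s`. -/
noncomputable def boostMatrix (s : ℝ) : Matrix (Fin 4) (Fin 4) ℝ :=
  !![(s + s⁻¹) / 2, (s - s⁻¹) / 2, 0, 0; (s - s⁻¹) / 2, (s + s⁻¹) / 2, 0, 0; 0, 0, 1, 0; 0, 0, 0, 1]

/-- The half turn in the plane of `e_1, e_2`. -/
def halfTurnMatrix : Matrix (Fin 4) (Fin 4) ℝ :=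
  !![1, 0, 0, 0; 0, -1, 0, 0; 0, 0, -1, 0; 0, 0, 0, 1]

theorem isLorentzMatrix_rotationMatrix {A B : ℝ} (h : A ^ 2 + B ^ 2 = 1) :
    IsLorentzMatrix (rotationMatrix A B) := by
  refine ⟨?_, ?_, by simp [rotationMatrix]⟩
  · ext i j
    fin_cases i <;> fin_cases j <;>
      simp [rotationMatrix, minkowskiEta, Matrix.mul_apply, Fin.sum_univ_succ,
        Matrix.diagonal_apply] <;> linarith
  · simp [rotationMatrix, Matrix.det_succ_row_zero, Fin.sum_univ_succ, Fin.succAbove]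
    linarith

theorem isLorentzMatrix_nullRotationMatrix (u v : ℝ) :
    IsLorentzMatrix (nullRotationMatrix u v) := by
  refine ⟨?_, ?_, ?_⟩
  · ext i j
    fin_cases i <;> fin_cases j <;>
      simp [nullRotationMatrix, minkowskiEta, Matrix.mul_apply, Fin.sum_univ_succ,
        Matrix.diagonal_apply] <;> ring
  · simp [nullRotationMatrix, Matrix.det_succ_row_zero, Fin.sum_univ_succ, Fin.succAbove]
    ring
  · simp only [nullRotationMatrix, Matrix.of_apply, Matrix.cons_val_zero]
    positivity

theorem isLorentzMatrix_boostMatrix {s : ℝ} (hs : 0 < s) : IsLorentzMatrix (boostMatrix s) := by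
  refine ⟨?_, ?_, ?_⟩
  · ext i j
    fin_cases i <;> fin_cases j <;>
      simp [boostMatrix, minkowskiEta, Matrix.mul_apply, Fin.sum_univ_succ,
        Matrix.diagonal_apply] <;> field_simp <;> ring
  · simp [boostMatrix, Matrix.det_succ_row_zero, Fin.sum_univ_succ, Fin.succAbove]
    field_simp
    ring
  · simp only [boostMatrix, Matrix.of_apply, Matrix.cons_val_zero]
    positivity

theorem isLorentzMatrix_halfTurnMatrix : IsLorentzMatrix halfTurnMatrix := by
  refine ⟨?_, ?_, by simp [halfTurnMatrix]⟩
  · ext i j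
    fin_cases i <;> fin_cases j <;>
      simp [halfTurnMatrix, minkowskiEta, Matrix.mul_apply, Fin.sum_univ_succ,
        Matrix.diagonal_apply]
  · simp [halfTurnMatrix, Matrix.det_succ_row_zero, Fin.sum_univ_succ, Fin.succAbove]

theorem rotationMatrix_one_zero : rotationMatrix 1 0 = 1 := by
  ext i j
  fin_cases i <;> fin_cases j <;> simp [rotationMatrix]

theorem nullRotationMatrix_zero : nullRotationMatrix 0 0 = 1 := by
  ext i j
  fin_cases i <;> fin_cases j <;> simp [nullRotationMatrix]

theorem nullRotationMatrix_mul_nullRotationMatrix (u v x y : ℝ) :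
    nullRotationMatrix u v * nullRotationMatrix x y = nullRotationMatrix (u + x) (v + y) := by
  ext i j
  fin_cases i <;> fin_cases j <;>
    simp [nullRotationMatrix, Matrix.mul_apply, Fin.sum_univ_succ] <;> ring

/-- The semidirect product law of plane motions: rotations act on the parameters of null rotations.
-/
theorem rotationMatrix_mul_nullRotationMatrix {A B : ℝ} (h : A ^ 2 + B ^ 2 = 1) (x y : ℝ) :
    rotationMatrix A B * nullRotationMatrix x y =
      nullRotationMatrix (A * x + B * y) (-B * x + A * y) * rotationMatrix A B := by
  have hs : (A * x + B * y) ^ 2 + (-B * x + A * y) ^ 2 = x ^ 2 + y ^ 2 := by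
    linear_combination (x ^ 2 + y ^ 2) * h
  rw [nullRotationMatrix, nullRotationMatrix, hs]
  ext i j
  fin_cases i <;> fin_cases j <;>
    simp [rotationMatrix, Matrix.mul_apply, Fin.sum_univ_succ] <;> grind

theorem mul_minkowskiEta_mul_transpose {Λ : Matrix (Fin 4) (Fin 4) ℝ}
    (h : Λᵀ * minkowskiEta * Λ = minkowskiEta) : Λ * minkowskiEta * Λᵀ = minkowskiEta := by
  have hη : minkowskiEta * minkowskiEta = 1 := by
    ext i j
    fin_cases i <;> fin_cases j <;> simp [minkowskiEta]
  have h1 : (minkowskiEta * Λᵀ * minkowskiEta) * Λ = 1 := by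
    rw [Matrix.mul_assoc, Matrix.mul_assoc, ← Matrix.mul_assoc Λᵀ, h, hη]
  have h2 := mul_eq_one_comm.1 h1
  calc Λ * minkowskiEta * Λᵀ = Λ * (minkowskiEta * Λᵀ * minkowskiEta) * minkowskiEta := by
        simp only [Matrix.mul_assoc, hη, Matrix.mul_one]
    _ = minkowskiEta := by rw [h2, Matrix.one_mul]

/-- The stabilizer of `e_0 + e_1` consists of products of null rotations and rotations. -/
theorem eq_nullRotationMatrix_mul_rotationMatrix {Λ : Matrix (Fin 4) (Fin 4) ℝ}
    (hΛ : IsLorentzMatrix Λ)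
    (h : ∀ j, (1 : Matrix (Fin 4) (Fin 4) ℝ) 0 j - Λ 0 j =
      (1 : Matrix (Fin 4) (Fin 4) ℝ) 1 j - Λ 1 j) :
    ∃ u v A B, A ^ 2 + B ^ 2 = 1 ∧ Λ = nullRotationMatrix u v * rotationMatrix A B := by
  -- The hypothesis says that the covector of k is fixed by the transpose of Λ; Λ η Λᵀ = η turns
  -- this into Λ k = k.
  have hk : Λ *ᵥ ![-1, -1, 0, 0] = ![-1, -1, 0, 0] := by
    have h1 : Λᵀ *ᵥ ![1, -1, 0, 0] = ![1, -1, 0, 0] := by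
      have a0 := h 0
      have a1 := h 1
      have a2 := h 2
      have a3 := h 3
      simp at a0 a1 a2 a3
      ext j
      fin_cases j <;> (simp [Matrix.mulVec, dotProduct, Fin.sum_univ_succ]; linarith)
    have h2 : minkowskiEta *ᵥ ![1, -1, 0, 0] = ![-1, -1, 0, 0] := by
      ext j
      fin_cases j <;> simp [minkowskiEta, Matrix.mulVec_diagonal]
    have h3 := congrArg (· *ᵥ ![1, -1, 0, 0]) (mul_minkowskiEta_mul_transpose hΛ.isometry)
    simpa only [← Matrix.mulVec_mulVec, h1, h2] using h3
  have hk' : ∀ i, Λ i 0 + Λ i 1 = ![1, 1, 0, 0] i := by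
    intro i
    have := congrFun hk i
    fin_cases i <;>
      simp [Matrix.mulVec, dotProduct, Fin.sum_univ_succ] at this ⊢ <;> linarith
  have hE : Λ = !![Λ 0 0, 1 - Λ 0 0, Λ 0 2, Λ 0 3; Λ 0 0 - 1, 2 - Λ 0 0, Λ 0 2, Λ 0 3;
      Λ 2 0, -Λ 2 0, Λ 2 2, Λ 2 3; Λ 3 0, -Λ 3 0, Λ 3 2, Λ 3 3] := by
    have a0 := h 0
    have a1 := h 1
    have a2 := h 2
    have a3 := h 3
    have b0 := hk' 0
    have b1 := hk' 1
    have b2 := hk' 2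
    have b3 := hk' 3
    simp at a0 a1 a2 a3 b0 b1 b2 b3
    ext i j
    fin_cases i <;> fin_cases j <;> simp <;> linarith
  have hi := hΛ.isometry
  have hd := hΛ.det_eq_one
  generalize Λ 0 0 = g, Λ 0 2 = p, Λ 0 3 = r, Λ 2 0 = u, Λ 2 2 = A, Λ 2 3 = B, Λ 3 0 = v,
    Λ 3 2 = C, Λ 3 3 = D at hE
  subst hE
  have e00 := congrFun (congrFun hi 0) 0
  have e02 := congrFun (congrFun hi 0) 2
  have e03 := congrFun (congrFun hi 0) 3
  have e22 := congrFun (congrFun hi 2) 2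
  have e33 := congrFun (congrFun hi 3) 3
  simp [minkowskiEta, Matrix.mul_apply, Fin.sum_univ_succ, Matrix.diagonal_apply] at e00 e02 e03 e22 e33
  simp [Matrix.det_succ_row_zero, Fin.sum_univ_succ, Fin.succAbove] at hd
  have hdet : A * D - B * C = 1 := by linarith
  -- The lower right block has unit columns and determinant 1, so it is a rotation; the determinant
  -- excludes reflections.
  have hsum : (A - D) ^ 2 + (B + C) ^ 2 = 0 := by linarith
  have hD : D = A := by nlinarith [sq_nonneg (A - D), sq_nonneg (B + C)]
  have hC : C = -B := by nlinarith [sq_nonneg (A - D), sq_nonneg (B + C)]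
  subst hD hC
  have hg : g = 1 + (u ^ 2 + v ^ 2) / 2 := by linarith
  have hp : p = u * D + v * -B := by linarith
  have hr : r = u * B + v * D := by linarith
  refine ⟨u, v, D, B, by linarith, ?_⟩
  rw [hg, hp, hr]
  ext i j
  fin_cases i <;> fin_cases j <;>
    simp [nullRotationMatrix, rotationMatrix, Matrix.mul_apply, Fin.sum_univ_succ] <;> ring

/-! ### Normal forms and their parameters -/

section Forms

variable {W M : Type*} [AddCommGroup W] [Module ℝ W] [AddTorsor W M]
  {S : MinkowskiStructure W} {P : M ≃ᵃ[ℝ] M} {hP : S.IsPoincare P}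

theorem exists_normal_form
    (hJ : ∃ q : M, P q ∈ S.causalFuture q \ {q})
    (hI : ∀ q : M, P q ∉ S.chronologicalFuture q) :
    (∃ (fr : S.Frame M) (A B : ℝ), A ^ 2 + B ^ 2 = 1 ∧
      HasMatrixForm fr P hP (augmented (rotationMatrix A B) ![-1, -1, 0, 0] 1)) ∨
    (∃ (fr : S.Frame M) (a : ℝ), a ≠ 0 ∧
      HasMatrixForm fr P hP (augmented (nullRotationMatrix a 0) ![-1, -1, 0, 0] 1)) := by
  obtain ⟨fr, Λ, hΛ, hrow, hG⟩ := S.exists_adapted_frame hP hJ hI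
  obtain ⟨u, v, A, B, hAB, rfl⟩ := eq_nullRotationMatrix_mul_rotationMatrix hΛ hrow
  rcases eq_or_ne A 1 with hA | hA
  · have hB : B = 0 := by rw [hA] at hAB; nlinarith
    rw [hA, hB, rotationMatrix_one_zero, Matrix.mul_one] at hG
    rcases eq_or_ne (u ^ 2 + v ^ 2) 0 with h0 | h0
    · have hu : u = 0 := by nlinarith [sq_nonneg u, sq_nonneg v]
      have hv : v = 0 := by nlinarith [sq_nonneg u, sq_nonneg v]
      left
      refine ⟨fr, 1, 0, by norm_num, ?_⟩
      rwa [hu, hv, nullRotationMatrix_zero, ← rotationMatrix_one_zero] at hG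
    · right
      have hr : √(u ^ 2 + v ^ 2) ^ 2 = u ^ 2 + v ^ 2 := Real.sq_sqrt (by positivity)
      have hr0 : √(u ^ 2 + v ^ 2) ≠ 0 := by
        intro h; rw [h] at hr; exact h0 (by rw [← hr]; ring)
      generalize √(u ^ 2 + v ^ 2) = r at hr hr0
      obtain ⟨C, hC⟩ : ∃ C, C = u / r := ⟨_, rfl⟩
      obtain ⟨D, hD⟩ : ∃ D, D = v / r := ⟨_, rfl⟩
      have hu : u = r * C := by rw [hC]; field_simp
      have hv : v = r * D := by rw [hD]; field_simp
      have hCD : C ^ 2 + D ^ 2 = 1 := by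
        rw [hC, hD]; field_simp; rw [hr]
      subst hu hv
      -- Rotating the transverse plane turns (u, v) into (r, 0).
      refine ⟨_, r, hr0, hG.transform (isLorentzMatrix_rotationMatrix (A := C) (B := -D)
        (by linarith)) 0 ?_ ?_⟩
      · ext i j
        fin_cases i <;> fin_cases j <;>
          simp [nullRotationMatrix, rotationMatrix, Matrix.mul_apply, Fin.sum_univ_succ] <;>
          grind
      · ext i
        fin_cases i <;>
          simp [nullRotationMatrix, rotationMatrix]
  · left
    have hd : (2 - 2 * A) ≠ 0 := by
      intro h; apply hA; linarith
    -- (x, y) is the fixed point of z ↦ R z + (u, v), with R the rotation of the plane; 2 - 2A is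
    -- the determinant of 1 - R. Conjugating by the null rotation of (x, y) removes the null
    -- rotation factor.
    obtain ⟨x, hx⟩ : ∃ x, x = ((1 - A) * u + B * v) / (2 - 2 * A) := ⟨_, rfl⟩
    obtain ⟨y, hy⟩ : ∃ y, y = ((1 - A) * v - B * u) / (2 - 2 * A) := ⟨_, rfl⟩
    have hu : u = (1 - A) * x - B * y := by
      rw [hx, hy]; field_simp; linear_combination - u * hAB
    have hv : v = B * x + (1 - A) * y := by
      rw [hx, hy]; field_simp; linear_combination - v * hAB
    refine ⟨_, A, B, hAB, hG.transform (isLorentzMatrix_nullRotationMatrix x y) 0 ?_ ?_⟩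
    · rw [Matrix.mul_assoc, rotationMatrix_mul_nullRotationMatrix hAB, ← Matrix.mul_assoc,
        nullRotationMatrix_mul_nullRotationMatrix, hu, hv]
      congr 2 <;> ring
    · ext i
      fin_cases i <;> simp [nullRotationMatrix]
      ring

/-- A boost along e_1 commutes with the rotation and rescales k. -/
theorem HasMatrixForm.rescale_rotation {fr : S.Frame M} {A B : ℝ}
    (h : HasMatrixForm fr P hP (augmented (rotationMatrix A B) ![-1, -1, 0, 0] 1))
    {lam : ℝ} (hl : 0 < lam) :
    ∃ fr' : S.Frame M,
      HasMatrixForm fr' P hP (augmented (rotationMatrix A B) ![-lam, -lam, 0, 0] 1) := by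
  refine ⟨_, h.transform (isLorentzMatrix_boostMatrix (inv_pos.2 hl)) 0 ?_ ?_⟩
  · ext i j
    fin_cases i <;> fin_cases j <;>
      simp [boostMatrix, rotationMatrix, Matrix.mul_apply, Fin.sum_univ_succ]
  · ext i
    fin_cases i <;>
      simp [boostMatrix] <;> field_simp <;> ring

/-- The half turn reverses both e_1 and the sense of rotation, so the sign of the angle is traded
for the sign of the translation along e_1. -/
theorem HasMatrixForm.flip_rotation {fr : S.Frame M} {A B lam : ℝ}
    (h : HasMatrixForm fr P hP (augmented (rotationMatrix A B) ![-lam, -lam, 0, 0] 1)) :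
    ∃ fr' : S.Frame M,
      HasMatrixForm fr' P hP (augmented (rotationMatrix A (-B)) ![-lam, lam, 0, 0] 1) := by
  refine ⟨_, h.transform isLorentzMatrix_halfTurnMatrix 0 ?_ ?_⟩
  · ext i j
    fin_cases i <;> fin_cases j <;>
      simp [halfTurnMatrix, rotationMatrix, Matrix.mul_apply, Fin.sum_univ_succ]
  · ext i
    fin_cases i <;> simp [halfTurnMatrix]

/-- Two independent freedoms are available: the boost by a / a' fixes the null rotation parameter,
and moving the origin along e_2 changes the translation by any multiple of k. Hence `a'` and `lam`
are both arbitrary. -/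
theorem HasMatrixForm.rescale_nullRotation {fr : S.Frame M} {a : ℝ} (ha : a ≠ 0)
    (h : HasMatrixForm fr P hP (augmented (nullRotationMatrix a 0) ![-1, -1, 0, 0] 1))
    {a' : ℝ} (ha' : a' ≠ 0) (lam : ℝ) :
    ∃ fr' : S.Frame M,
      HasMatrixForm fr' P hP (augmented (nullRotationMatrix a' 0) ![-lam, -lam, 0, 0] 1) := by
  -- The boost factor must be positive; the half turn in the plane of e_2, e_3 changes the sign of
  -- `a`.
  wlog hs : 0 < a / a' generalizing fr a
  · refine this (fr := fr.transform (rotationMatrix (-1) 0)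
      (isLorentzMatrix_rotationMatrix (by norm_num)) 0) (a := -a) (neg_ne_zero.2 ha)
      (h.transform _ 0 ?_ ?_) ?_
    · ext i j
      fin_cases i <;> fin_cases j <;>
        simp [nullRotationMatrix, rotationMatrix, Matrix.mul_apply, Fin.sum_univ_succ]
    · ext i
      fin_cases i <;> simp [rotationMatrix]
    · have h0 : a / a' ≠ 0 := div_ne_zero ha ha'
      rw [neg_div]
      rcases lt_or_gt_of_ne h0 with h1 | h1
      · linarith
      · exact absurd h1 hs
  · refine ⟨_, h.transform (isLorentzMatrix_boostMatrix hs)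
      ![0, 0, (1 - lam * (a / a')) / a, 0] ?_ ?_⟩
    · ext i j
      fin_cases i <;> fin_cases j <;>
        simp [boostMatrix, nullRotationMatrix, Matrix.mul_apply, Fin.sum_univ_succ] <;>
        field_simp <;> ring
    · ext i
      fin_cases i <;>
        simp [boostMatrix, nullRotationMatrix] <;>
        field_simp <;> ring

theorem lightlikeScrewGenerator_eq (ω ε : ℝ) : ω • genJ1 - ε • genP1 + genH =
    !![0, 0, 0, 0, -1; 0, 0, 0, 0, -ε; 0, 0, 0, ω, 0; 0, 0, -ω, 0, 0; 0, 0, 0, 0, 0] := by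
  ext i j
  fin_cases i <;> fin_cases j <;>
    simp [genJ1, genP1, genH, genLorentz, genTranslation, augmented, minkowskiEta]

theorem exp_lightlikeScrewGenerator (ω ε lam : ℝ) :
    NormedSpace.exp (lam • (ω • genJ1 - ε • genP1 + genH)) =
      !![1, 0, 0, 0, -lam;
         0, 1, 0, 0, -ε * lam;
         0, 0, Real.cos (ω * lam), Real.sin (ω * lam), 0;
         0, 0, -Real.sin (ω * lam), Real.cos (ω * lam), 0;
         0, 0, 0, 0, 1] := by
  obtain ⟨J, hJ⟩ : ∃ J : Matrix (Fin 5) (Fin 5) ℝ, J =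
    !![0, 0, 0, 0, 0; 0, 0, 0, 0, 0; 0, 0, 0, 1, 0; 0, 0, -1, 0, 0; 0, 0, 0, 0, 0] := ⟨_, rfl⟩
  obtain ⟨B, hB⟩ : ∃ B : Matrix (Fin 5) (Fin 5) ℝ, B =
    !![0, 0, 0, 0, -lam; 0, 0, 0, 0, -ε * lam; 0, 0, 0, 0, 0; 0, 0, 0, 0, 0;
      0, 0, 0, 0, 0] := ⟨_, rfl⟩
  have hs : lam • (ω • genJ1 - ε • genP1 + genH) = (ω * lam) • J + B := by
    rw [lightlikeScrewGenerator_eq, hJ, hB]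
    ext i j
    fin_cases i <;> fin_cases j <;> simp <;> ring
  have hJJ : J * J = Matrix.diagonal ![0, 0, -1, -1, 0] := by
    rw [hJ]
    ext i j
    fin_cases i <;> fin_cases j <;> simp
  rw [hs, Matrix.exp_rotation_add_translation]
  · rw [hJJ, hJ, hB]
    ext i j
    fin_cases i <;> fin_cases j <;> simp
  · rw [hJJ, hJ]
    ext i j
    fin_cases i <;> fin_cases j <;> simp
  · rw [hJ, hB]
    ext i j
    fin_cases i <;> fin_cases j <;> simp
  · rw [hJ, hB]
    ext i j
    fin_cases i <;> fin_cases j <;> simp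
  · rw [hB]
    ext i j
    fin_cases i <;> fin_cases j <;> simp

theorem nullRotationGenerator_eq (κ : ℝ) : κ • (genK2 - genJ3) - genP1 + genH =
    !![0, 0, -κ, 0, -1; 0, 0, -κ, 0, -1; -κ, κ, 0, 0, 0; 0, 0, 0, 0, 0; 0, 0, 0, 0, 0] := by
  ext i j
  fin_cases i <;> fin_cases j <;>
    simp [genK2, genJ3, genP1, genH, genLorentz, genTranslation, augmented, minkowskiEta]

theorem exp_nullRotationGenerator (κ lam : ℝ) :
    NormedSpace.exp (lam • (κ • (genK2 - genJ3) - genP1 + genH)) =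
      !![1 + (κ * lam) ^ 2 / 2, -((κ * lam) ^ 2 / 2), -(κ * lam), 0, -lam;
         (κ * lam) ^ 2 / 2, 1 - (κ * lam) ^ 2 / 2, -(κ * lam), 0, -lam;
         -(κ * lam), κ * lam, 1, 0, 0;
         0, 0, 0, 1, 0;
         0, 0, 0, 0, 1] := by
  obtain ⟨X, hX⟩ : ∃ X : Matrix (Fin 5) (Fin 5) ℝ, X =
    !![0, 0, -(κ * lam), 0, -lam; 0, 0, -(κ * lam), 0, -lam; -(κ * lam), κ * lam, 0, 0, 0;
      0, 0, 0, 0, 0; 0, 0, 0, 0, 0] := ⟨_, rfl⟩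
  have hs : lam • (κ • (genK2 - genJ3) - genP1 + genH) = X := by
    rw [nullRotationGenerator_eq, hX]
    ext i j
    fin_cases i <;> fin_cases j <;> simp <;> ring
  have hXX : X * X = !![(κ * lam) ^ 2, -(κ * lam) ^ 2, 0, 0, 0;
      (κ * lam) ^ 2, -(κ * lam) ^ 2, 0, 0, 0; 0, 0, 0, 0, 0; 0, 0, 0, 0, 0; 0, 0, 0, 0, 0] := by
    rw [hX]
    ext i j
    fin_cases i <;> fin_cases j <;> simp [Matrix.mul_apply, Fin.sum_univ_succ] <;> ring
  rw [hs, Matrix.exp_of_cube_eq_zero]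
  · rw [hXX, hX]
    ext i j
    fin_cases i <;> fin_cases j <;> simp <;> ring
  · rw [hXX, hX]
    ext i j
    fin_cases i <;> fin_cases j <;> simp [Matrix.mul_apply, Fin.sum_univ_succ]

theorem isLightlikeScrewForm_of_hasMatrixForm {fr : S.Frame M} {ω ε lam : ℝ}
    (h : HasMatrixForm fr P hP
      (augmented (rotationMatrix (Real.cos (ω * lam)) (Real.sin (ω * lam)))
        ![-lam, -ε * lam, 0, 0] 1)) :
    IsLightlikeScrewForm fr P hP ω ε lam := by
  refine ⟨?_, by rw [lightlikeScrewGenerator_eq], exp_lightlikeScrewGenerator ω ε lam⟩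
  rw [exp_lightlikeScrewGenerator]
  convert h using 1
  ext i j
  fin_cases i <;> fin_cases j <;> simp [augmented, rotationMatrix]

theorem isNullRotationForm_of_hasMatrixForm {fr : S.Frame M} {κ lam : ℝ}
    (h : HasMatrixForm fr P hP
      (augmented (nullRotationMatrix (-(κ * lam)) 0) ![-lam, -lam, 0, 0] 1)) :
    IsNullRotationForm fr P hP κ lam := by
  refine ⟨?_, by rw [nullRotationGenerator_eq], exp_nullRotationGenerator κ lam⟩
  rw [exp_nullRotationGenerator]
  convert h using 1
  ext i j
  fin_cases i <;> fin_cases j <;> simp [augmented, nullRotationMatrix]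

end Forms

/-! ### Logarithms of the normal forms in so(1,3) -/

/-- The general element of `so(1,3)`. -/
def so13Matrix (x₁ x₂ x₃ y₁ y₂ y₃ : ℝ) : Matrix (Fin 4) (Fin 4) ℝ :=
  !![0, x₁, x₂, x₃; x₁, 0, y₃, -y₂; x₂, -y₃, 0, y₁; x₃, y₂, -y₁, 0]

theorem IsSO13.exists_eq {F : Matrix (Fin 4) (Fin 4) ℝ} (h : IsSO13 F) :
    ∃ x₁ x₂ x₃ y₁ y₂ y₃, F = so13Matrix x₁ x₂ x₃ y₁ y₂ y₃ := by
  refine ⟨F 0 1, F 0 2, F 0 3, F 2 3, F 3 1, F 1 2, ?_⟩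
  have hs : ∀ i j, minkowskiEta i i * F i j + minkowskiEta j j * F j i = 0 := by
    intro i j
    have := congrFun (congrFun h i) j
    simp [minkowskiEta, Matrix.diagonal_mul] at this ⊢
    linarith
  have h00 := hs 0 0
  have h01 := hs 0 1
  have h02 := hs 0 2
  have h03 := hs 0 3
  have h11 := hs 1 1
  have h12 := hs 1 2
  have h13 := hs 1 3
  have h22 := hs 2 2
  have h23 := hs 2 3
  have h33 := hs 3 3
  simp [minkowskiEta] at h00 h01 h02 h03 h11 h12 h13 h22 h23 h33
  ext i j
  fin_cases i <;> fin_cases j <;> simp [so13Matrix] <;> linarith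

theorem isSO13_so13Matrix (x₁ x₂ x₃ y₁ y₂ y₃ : ℝ) : IsSO13 (so13Matrix x₁ x₂ x₃ y₁ y₂ y₃) := by
  ext i j
  fin_cases i <;> fin_cases j <;>
    simp [so13Matrix, minkowskiEta, Matrix.diagonal_mul]

theorem invariantI1_so13Matrix (x₁ x₂ x₃ y₁ y₂ y₃ : ℝ) :
    invariantI1 (so13Matrix x₁ x₂ x₃ y₁ y₂ y₃) =
      (y₁ ^ 2 + y₂ ^ 2 + y₃ ^ 2 - x₁ ^ 2 - x₂ ^ 2 - x₃ ^ 2) / 2 := by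
  simp [invariantI1, so13Matrix, Matrix.trace, Fin.sum_univ_succ]
  ring

theorem det_so13Matrix_sub (x₁ x₂ x₃ y₁ y₂ y₃ a : ℝ) :
    (so13Matrix x₁ x₂ x₃ y₁ y₂ y₃ - a • (1 : Matrix (Fin 4) (Fin 4) ℝ)).det =
      a ^ 4 + 2 * invariantI1 (so13Matrix x₁ x₂ x₃ y₁ y₂ y₃) * a ^ 2
        - (x₁ * y₁ + x₂ * y₂ + x₃ * y₃) ^ 2 := by
  rw [invariantI1_so13Matrix]
  have : so13Matrix x₁ x₂ x₃ y₁ y₂ y₃ - a • (1 : Matrix (Fin 4) (Fin 4) ℝ) =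
      !![-a, x₁, x₂, x₃; x₁, -a, y₃, -y₂; x₂, -y₃, -a, y₁; x₃, y₂, -y₁, -a] := by
    ext i j
    fin_cases i <;> fin_cases j <;> simp [so13Matrix]
  rw [this]
  simp [Matrix.det_succ_row_zero, Fin.sum_univ_succ, Fin.succAbove]
  ring

/-- When the second invariant x · y vanishes, the characteristic polynomial is a⁴ + 2 I₁ a²; the
cubic relation gains one factor over Cayley–Hamilton. -/
theorem so13Matrix_cube {x₁ x₂ x₃ y₁ y₂ y₃ : ℝ} (h : x₁ * y₁ + x₂ * y₂ + x₃ * y₃ = 0) :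
    so13Matrix x₁ x₂ x₃ y₁ y₂ y₃ * so13Matrix x₁ x₂ x₃ y₁ y₂ y₃ * so13Matrix x₁ x₂ x₃ y₁ y₂ y₃ =
      -((2 * invariantI1 (so13Matrix x₁ x₂ x₃ y₁ y₂ y₃)) • so13Matrix x₁ x₂ x₃ y₁ y₂ y₃) := by
  rw [invariantI1_so13Matrix]
  ext i j
  fin_cases i <;> fin_cases j <;>
    simp [so13Matrix, Matrix.mul_apply, Fin.sum_univ_succ] <;> grind

/-- Commuting with exp F says nothing here. Instead, a real eigenvalue a of F satisfies exp a = 1,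
so a = 0; this forces the second invariant to vanish and I₁ ≥ 0, and the closed forms of the
exponential finish. -/
theorem so13_of_exp_eq_one {F : Matrix (Fin 4) (Fin 4) ℝ} (hF : IsSO13 F)
    (h : NormedSpace.exp F = 1) :
    0 ≤ invariantI1 F ∧ (invariantI1 F = 0 → F = 0) ∧
      Real.cos √(2 * invariantI1 F) = 1 ∧ Real.sin √(2 * invariantI1 F) = 0 := by
  obtain ⟨x₁, x₂, x₃, y₁, y₂, y₃, rfl⟩ := hF.exists_eq
  have hdet := det_so13Matrix_sub x₁ x₂ x₃ y₁ y₂ y₃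
  have hzero : so13Matrix x₁ x₂ x₃ y₁ y₂ y₃ = 0 →
      invariantI1 (so13Matrix x₁ x₂ x₃ y₁ y₂ y₃) = 0 := by
    intro h
    rw [h]
    simp [invariantI1]
  have hcube := so13Matrix_cube (x₁ := x₁) (x₂ := x₂) (x₃ := x₃) (y₁ := y₁) (y₂ := y₂) (y₃ := y₃)
  generalize so13Matrix x₁ x₂ x₃ y₁ y₂ y₃ = F at *
  generalize x₁ * y₁ + x₂ * y₂ + x₃ * y₃ = m at *
  generalize invariantI1 F = I at *
  have hr : √(I ^ 2 + m ^ 2) ^ 2 = I ^ 2 + m ^ 2 := Real.sq_sqrt (by positivity)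
  have ht : 0 ≤ √(I ^ 2 + m ^ 2) - I := by
    have : I ≤ √(I ^ 2 + m ^ 2) := Real.le_sqrt_of_sq_le (by nlinarith [sq_nonneg m])
    linarith
  have ha : √(√(I ^ 2 + m ^ 2) - I) ^ 2 = √(I ^ 2 + m ^ 2) - I := Real.sq_sqrt ht
  -- The nonnegative real root of the characteristic polynomial a⁴ + 2 I a² - m².
  have hev : √(√(I ^ 2 + m ^ 2) - I) = 0 := by
    generalize √(√(I ^ 2 + m ^ 2) - I) = a at ha
    obtain ⟨v, hv, hFv⟩ := Matrix.exists_mulVec_eq_zero_iff.2 (show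
      (F - a • (1 : Matrix (Fin 4) (Fin 4) ℝ)).det = 0 by
        rw [hdet]
        have : a ^ 4 = (a ^ 2) ^ 2 := by ring
        rw [this, ha]
        linear_combination hr)
    rw [Matrix.sub_mulVec, Matrix.smul_mulVec, Matrix.one_mulVec, sub_eq_zero] at hFv
    have h1 := Matrix.exp_mulVec_of_eigenvector hFv
    rw [h, Matrix.one_mulVec] at h1
    obtain ⟨i, hi⟩ := Function.ne_iff.1 hv
    have h2 : Real.exp a * v i = 1 * v i := by
      rw [one_mul]; exact (congrFun h1 i).symm
    exact (Real.exp_eq_one_iff a).1 (mul_right_cancel₀ hi h2)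
  rw [hev] at ha
  have hI0 : 0 ≤ I := by
    have := Real.sqrt_nonneg (I ^ 2 + m ^ 2)
    linarith
  have hm : m = 0 := by
    have : √(I ^ 2 + m ^ 2) = I := by linarith
    rw [this] at hr
    have : m ^ 2 = 0 := by linarith
    exact pow_eq_zero_iff (two_ne_zero) |>.1 this
  specialize hcube hm
  rcases hI0.eq_or_lt with hI | hI
  · subst hI
    refine ⟨le_rfl, fun _ => ?_, by simp, by simp⟩
    rw [mul_zero, zero_smul, neg_zero] at hcube
    rw [Matrix.exp_of_cube_eq_zero hcube, add_assoc, add_eq_left] at h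
    have h2 : F * F = 0 := by
      have := congrArg (· * F) h
      simpa [add_mul, hcube] using this
    simpa [h2] using h
  · have hb : √(2 * I) ^ 2 = 2 * I := Real.sq_sqrt (by linarith)
    have hb0 : 0 < √(2 * I) := Real.sqrt_pos.2 (by linarith)
    refine ⟨hI0, fun h0 => absurd h0 hI.ne', ?_⟩
    generalize √(2 * I) = b at hb hb0
    rw [← hb] at hcube
    obtain ⟨J, hJ⟩ : ∃ J, J = b⁻¹ • F := ⟨_, rfl⟩
    have hFJ : F = b • J + 0 := by rw [hJ, smul_inv_smul₀ hb0.ne', add_zero]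
    have hJJ : J * J * J = -J := by
      rw [hJ]
      simp only [smul_mul_assoc, mul_smul_comm, hcube, smul_neg, smul_smul]
      congr 2
      field_simp
    rw [hFJ, Matrix.exp_rotation_add_translation hJJ (zero_mul _) (mul_zero _) (zero_mul _),
      add_zero, add_assoc, add_eq_left] at h
    have hmul := congrArg (· * J) h
    simp only [add_mul, smul_mul_assoc, hJJ, zero_mul, smul_neg] at hmul
    have hJ0 : J ≠ 0 := by
      rintro rfl
      exact hI.ne' (hzero (by simpa using hFJ))
    -- Eliminates J² between sin b · J + (1 - cos b) · J² = 0 and the same relation multiplied by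
    -- `J`, where J³ = -J.
    have hz : (Real.sin b ^ 2 + (1 - Real.cos b) ^ 2) • J = 0 := by
      have h1 := congrArg (Real.sin b • ·) h
      have h2 := congrArg ((1 - Real.cos b) • ·) hmul
      simp only [smul_add, smul_smul, smul_zero, smul_neg] at h1 h2
      rw [← sub_self (0 : Matrix (Fin 4) (Fin 4) ℝ)]
      nth_rewrite 1 [← h1]
      rw [← h2]
      module
    have hsum := (smul_eq_zero.1 hz).resolve_right hJ0
    constructor <;> nlinarith [sq_nonneg (Real.sin b), sq_nonneg (1 - Real.cos b)]

theorem exp_so13Matrix_rotation (b : ℝ) :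
    NormedSpace.exp (so13Matrix 0 0 0 b 0 0) = rotationMatrix (Real.cos b) (Real.sin b) := by
  have hs : so13Matrix 0 0 0 b 0 0 = b • so13Matrix 0 0 0 1 0 0 + 0 := by
    ext i j
    fin_cases i <;> fin_cases j <;> simp [so13Matrix]
  have hJ : so13Matrix 0 0 0 1 0 0 * so13Matrix 0 0 0 1 0 0 = Matrix.diagonal ![0, 0, -1, -1] := by
    ext i j
    fin_cases i <;> fin_cases j <;> simp [so13Matrix]
  rw [hs, Matrix.exp_rotation_add_translation _ (zero_mul _) (mul_zero _) (zero_mul _), hJ]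
  · ext i j
    fin_cases i <;> fin_cases j <;> simp [so13Matrix, rotationMatrix]
  · rw [hJ]
    ext i j
    fin_cases i <;> fin_cases j <;> simp [so13Matrix]

theorem so13_of_exp_eq_rotationMatrix {F : Matrix (Fin 4) (Fin 4) ℝ} (hF : IsSO13 F) {A B : ℝ}
    (hAB : A ^ 2 + B ^ 2 = 1) (h : NormedSpace.exp F = rotationMatrix A B) :
    0 ≤ invariantI1 F ∧ (invariantI1 F = 0 → F = 0) ∧
      ∃ σ : ℝ, (σ = 1 ∨ σ = -1) ∧ Real.cos √(2 * invariantI1 F) = A ∧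
        Real.sin √(2 * invariantI1 F) = σ * B := by
  rcases eq_or_ne A 1 with rfl | hA
  · have hB : B = 0 := by nlinarith
    subst hB
    rw [rotationMatrix_one_zero] at h
    obtain ⟨h1, h2, h3, h4⟩ := so13_of_exp_eq_one hF h
    exact ⟨h1, h2, 1, Or.inl rfl, h3, by rw [h4]; ring⟩
  · have hc : F * rotationMatrix A B = rotationMatrix A B * F := by
      rw [← h]; exact (Commute.refl F).exp_right
    have hd : (2 - 2 * A) ≠ 0 := by
      intro h; apply hA; linarith
    obtain ⟨x₁, x₂, x₃, y₁, y₂, y₃, rfl⟩ := hF.exists_eq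
    have c02 := congrFun (congrFun hc 0) 2
    have c03 := congrFun (congrFun hc 0) 3
    have c12 := congrFun (congrFun hc 1) 2
    have c13 := congrFun (congrFun hc 1) 3
    simp [so13Matrix, rotationMatrix, Matrix.mul_apply, Fin.sum_univ_succ] at c02 c03 c12 c13
    have hx₂ : x₂ = 0 := by
      apply (mul_eq_zero.1 _).resolve_left hd
      linear_combination (A - 1) * c02 + B * c03 - x₂ * hAB
    have hx₃ : x₃ = 0 := by
      apply (mul_eq_zero.1 _).resolve_left hd
      linear_combination (A - 1) * c03 - B * c02 - x₃ * hAB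
    have hy₃ : y₃ = 0 := by
      apply (mul_eq_zero.1 _).resolve_left hd
      linear_combination (A - 1) * c12 + B * c13 - y₃ * hAB
    have hy₂ : y₂ = 0 := by
      apply (mul_eq_zero.1 _).resolve_left hd
      linear_combination -(A - 1) * c13 + B * c12 - y₂ * hAB
    subst hx₂ hx₃ hy₂ hy₃
    have hk : so13Matrix x₁ 0 0 y₁ 0 0 *ᵥ ![1, 1, 0, 0] = x₁ • ![1, 1, 0, 0] := by
      ext i
      fin_cases i <;> simp [so13Matrix]
    have hx₁ := Matrix.exp_mulVec_of_eigenvector hk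
    rw [h] at hx₁
    have hx₁ := congrFun hx₁ 0
    simp [rotationMatrix] at hx₁
    obtain rfl : x₁ = 0 := (Real.exp_eq_one_iff _).1 hx₁.symm
    rw [exp_so13Matrix_rotation] at h
    have hcos := congrFun (congrFun h 2) 2
    have hsin := congrFun (congrFun h 2) 3
    simp [rotationMatrix] at hcos hsin
    rw [invariantI1_so13Matrix]
    have hI : 2 * ((y₁ ^ 2 + 0 ^ 2 + 0 ^ 2 - 0 ^ 2 - 0 ^ 2 - 0 ^ 2) / 2) = y₁ ^ 2 := by ring
    rw [hI, Real.sqrt_sq_eq_abs, Real.cos_abs]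
    refine ⟨by nlinarith [sq_nonneg y₁], fun h0 => ?_, ?_⟩
    · have : y₁ = 0 := by nlinarith
      subst this
      exact absurd (by simpa using hcos.symm) hA
    · rcases abs_choice y₁ with h1 | h1
      · exact ⟨1, Or.inl rfl, hcos, by rw [h1, hsin, one_mul]⟩
      · exact ⟨-1, Or.inr rfl, hcos, by rw [h1, Real.sin_neg, hsin, neg_one_mul]⟩

theorem so13_of_exp_eq_nullRotationMatrix {F : Matrix (Fin 4) (Fin 4) ℝ} (hF : IsSO13 F) {a : ℝ}
    (ha : a ≠ 0) (h : NormedSpace.exp F = nullRotationMatrix a 0) :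
    invariantI1 F = 0 ∧ F ≠ 0 := by
  constructor
  · obtain ⟨N, hN⟩ : ∃ N : Matrix (Fin 4) (Fin 4) ℝ, N =
      !![0, 0, 1, 0; 0, 0, 1, 0; 1, -1, 0, 0; 0, 0, 0, 0] := ⟨_, rfl⟩
    have hc : F * nullRotationMatrix a 0 = nullRotationMatrix a 0 * F := by
      rw [← h]; exact (Commute.refl F).exp_right
    have hc' : F * (nullRotationMatrix a 0 * nullRotationMatrix a 0) =
        (nullRotationMatrix a 0 * nullRotationMatrix a 0) * F := by
      rw [← Matrix.mul_assoc, hc, Matrix.mul_assoc, hc, Matrix.mul_assoc]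
    -- The nilpotent logarithm a N is a polynomial in its exponential, since N³ = 0; so F, which
    -- commutes with exp F, commutes with `N`.
    have hlin : (2 * a) • N = (4 : ℝ) • nullRotationMatrix a 0
        - nullRotationMatrix a 0 * nullRotationMatrix a 0 - (3 : ℝ) • 1 := by
      rw [nullRotationMatrix_mul_nullRotationMatrix, hN]
      ext i j
      fin_cases i <;> fin_cases j <;> simp [nullRotationMatrix] <;> ring
    have hcN : F * N = N * F := by
      apply smul_right_injective _ (mul_ne_zero two_ne_zero ha)
      change (2 * a) • (F * N) = (2 * a) • (N * F)
      rw [← mul_smul_comm, ← smul_mul_assoc, hlin]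
      simp only [mul_sub, sub_mul, mul_smul_comm, smul_mul_assoc, hc, hc', mul_one, one_mul]
    obtain ⟨x₁, x₂, x₃, y₁, y₂, y₃, rfl⟩ := hF.exists_eq
    rw [hN] at hcN
    have c01 := congrFun (congrFun hcN 0) 1
    have c02 := congrFun (congrFun hcN 0) 2
    have c03 := congrFun (congrFun hcN 0) 3
    have c20 := congrFun (congrFun hcN 2) 0
    have c23 := congrFun (congrFun hcN 2) 3
    have c30 := congrFun (congrFun hcN 3) 0
    have c32 := congrFun (congrFun hcN 3) 2
    simp [so13Matrix, Matrix.mul_apply, Fin.sum_univ_succ] at c01 c02 c03 c20 c23 c30 c32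
    rw [invariantI1_so13Matrix]
    grind
  · rintro rfl
    rw [NormedSpace.exp_zero] at h
    have := congrFun (congrFun h 0) 2
    simp [nullRotationMatrix] at this
    exact ha this.symm

/-! ### Change of frame for logarithms -/

section Conjugation

variable {W M : Type*} [AddCommGroup W] [Module ℝ W] [AddTorsor W M]
  {S : MinkowskiStructure W} {P : M ≃ᵃ[ℝ] M} {hP : S.IsPoincare P}

theorem HasMatrixForm.exp_conj {fr : S.Frame M} {F : Matrix (Fin 4) (Fin 4) ℝ} {v : Fin 4 → ℝ}
    (hF : IsSO13 F) (h : HasMatrixForm fr P hP (NormedSpace.exp (augmented F v 0)))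
    (fr' : S.Frame M) :
    ∃ (F' : Matrix (Fin 4) (Fin 4) ℝ) (v' : Fin 4 → ℝ), IsSO13 F' ∧
      HasMatrixForm fr' P hP (NormedSpace.exp (augmented F' v' 0)) ∧
      invariantI1 F' = invariantI1 F ∧ (F' = 0 ↔ F = 0) := by
  obtain ⟨T, hT⟩ : ∃ T, T = fr'.basis.toMatrix fr.basis := ⟨_, rfl⟩
  obtain ⟨T', hT'⟩ : ∃ T', T' = fr.basis.toMatrix fr'.basis := ⟨_, rfl⟩
  have hTT' : T * T' = 1 := by
    rw [hT, hT', Module.Basis.toMatrix_mul_toMatrix, Module.Basis.toMatrix_self]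
  have hT'T : T' * T = 1 := mul_eq_one_comm.1 hTT'
  have hη : minkowskiEta * T = T'ᵀ * minkowskiEta := by
    have := (MinkowskiStructure.Frame.isLorentzMatrix_toMatrix fr' fr).isometry
    rw [← hT'] at this
    calc minkowskiEta * T = T'ᵀ * minkowskiEta * T' * T := by rw [this]
      _ = T'ᵀ * minkowskiEta := by rw [Matrix.mul_assoc, hT'T, Matrix.mul_one]
  obtain ⟨v', hv'⟩ : ∃ v', fr.transition fr' * augmented F v 0 * fr'.transition fr =
      augmented (T * F * T') v' 0 := by
    rw [MinkowskiStructure.Frame.transition, MinkowskiStructure.Frame.transition, augmented_mul,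
      augmented_mul, ← hT, ← hT', one_mul, zero_mul]
    exact ⟨_, rfl⟩
  refine ⟨T * F * T', v', ?_, ?_, ?_, ?_⟩
  · have h1 : minkowskiEta * (T * F * T') = T'ᵀ * (minkowskiEta * F) * T' := by
      simp only [← Matrix.mul_assoc, hη]
    rw [IsSO13, h1, Matrix.transpose_mul, Matrix.transpose_mul, Matrix.transpose_transpose,
      ← Matrix.mul_assoc T'ᵀ _ T', ← Matrix.add_mul, ← Matrix.mul_add, hF, Matrix.mul_zero, Matrix.zero_mul]
  · have hinv : fr.transition fr' * fr'.transition fr = 1 := by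
      rw [MinkowskiStructure.Frame.transition_mul_transition,
        MinkowskiStructure.Frame.transition_self]
    have hinv' : fr'.transition fr = (fr.transition fr')⁻¹ := (Matrix.inv_eq_right_inv hinv).symm
    have hu : IsUnit (fr.transition fr') := IsUnit.of_mul_eq_one _ hinv
    have := h.conj fr'
    rw [← hv', hinv', Matrix.exp_conj _ _ hu, ← hinv']
    exact this
  · have : T * F * T' * (T * F * T') = T * (F * F) * T' := by
      calc T * F * T' * (T * F * T') = T * F * (T' * T) * (F * T') := by
            simp only [Matrix.mul_assoc]
        _ = T * (F * F) * T' := by rw [hT'T, Matrix.mul_one]; simp only [Matrix.mul_assoc]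
    rw [invariantI1, invariantI1, this, Matrix.trace_mul_comm, ← Matrix.mul_assoc, hT'T,
      Matrix.one_mul]
  · constructor
    · intro h0
      calc F = T' * (T * F * T') * T := by
            rw [Matrix.mul_assoc, Matrix.mul_assoc, Matrix.mul_assoc, hT'T, Matrix.mul_one,
              ← Matrix.mul_assoc, hT'T, Matrix.one_mul]
        _ = 0 := by rw [h0]; simp
    · rintro rfl
      simp

end Conjugation

/-! ### The classification -/

theorem theorem4p13 {W M : Type*} [AddCommGroup W] [Module ℝ W] [AddTorsor W M]
    (S : MinkowskiStructure W) (P : M ≃ᵃ[ℝ] M) (hP : S.IsPoincare P)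
    (hJ : ∃ q : M, P q ∈ S.causalFuture q \ {q})
    (hI : ∀ q : M, P q ∉ S.chronologicalFuture q) :
    ((∃ (fr : S.Frame M) (ω ε lam : ℝ), 0 < lam ∧ 0 < ω ∧ (ε = 1 ∨ ε = -1) ∧
        IsLightlikeScrewForm fr P hP ω ε lam) ∨
      (∃ (fr : S.Frame M) (κ lam : ℝ), 0 < lam ∧ κ ≠ 0 ∧
        IsNullRotationForm fr P hP κ lam)) ∧
    (∀ fr : S.Frame M, ∃ (F : Matrix (Fin 4) (Fin 4) ℝ) (w : Fin 4 → ℝ), IsSO13 F ∧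
      HasMatrixForm fr P hP (NormedSpace.exp (augmented F (-w) 0))) ∧
    (∀ (fr : S.Frame M) (F : Matrix (Fin 4) (Fin 4) ℝ) (w : Fin 4 → ℝ), IsSO13 F →
      HasMatrixForm fr P hP (NormedSpace.exp (augmented F (-w) 0)) →
      0 ≤ invariantI1 F ∧
      ((0 < invariantI1 F ∨ F = 0) →
        ∃ ε : ℝ, (ε = 1 ∨ ε = -1) ∧
          ∀ lam ω : ℝ, 0 < lam → 0 ≤ ω → lam * ω = Real.sqrt (2 * invariantI1 F) →
            ∃ fr' : S.Frame M, IsLightlikeScrewForm fr' P hP ω ε lam) ∧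
      ((invariantI1 F = 0 ∧ F ≠ 0) →
        ∀ lam κ : ℝ, 0 < lam → κ ≠ 0 →
          ∃ fr' : S.Frame M, IsNullRotationForm fr' P hP κ lam)) := by
  have hexp : ∀ {fr : S.Frame M} {X F : Matrix _ _ ℝ} {v : Fin 4 → ℝ},
      IsSO13 F → X = augmented F v 0 → HasMatrixForm fr P hP (NormedSpace.exp X) →
      ∀ fr : S.Frame M, ∃ (F : Matrix (Fin 4) (Fin 4) ℝ) (w : Fin 4 → ℝ), IsSO13 F ∧
        HasMatrixForm fr P hP (NormedSpace.exp (augmented F (-w) 0)) := by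
    rintro fr X F v hF rfl h fr'
    obtain ⟨F', v', hF', h', -⟩ := h.exp_conj hF fr'
    exact ⟨F', -v', hF', by rwa [neg_neg]⟩
  rcases exists_normal_form (hP := hP) hJ hI with ⟨fr₁, A, B, hAB, hG⟩ | ⟨fr₁, a, ha, hG⟩
  · obtain ⟨ω, hω, hcos, hsin⟩ : ∃ ω : ℝ, 0 < ω ∧ Real.cos ω = A ∧ Real.sin ω = B := by
      have hn : ‖(⟨A, B⟩ : ℂ)‖ = 1 := by
        rw [Complex.norm_def, Complex.normSq_mk, ← sq, ← sq, hAB, Real.sqrt_one]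
      have hz : (⟨A, B⟩ : ℂ) ≠ 0 := by
        intro h; rw [h, norm_zero] at hn; exact zero_ne_one hn
      -- The added turn makes `ω` strictly positive, also when the rotation is trivial and `P` is a
      -- null translation.
      refine ⟨Complex.arg ⟨A, B⟩ + 2 * Real.pi, ?_, ?_, ?_⟩
      · linarith [Complex.neg_pi_lt_arg ⟨A, B⟩, Real.pi_pos]
      · rw [Real.cos_add_two_pi, Complex.cos_arg hz, hn, div_one]
      · rw [Real.sin_add_two_pi, Complex.sin_arg, hn, div_one]
    have hscrew : IsLightlikeScrewForm fr₁ P hP ω 1 1 := by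
      apply isLightlikeScrewForm_of_hasMatrixForm
      simpa [hcos, hsin] using hG
    refine ⟨Or.inl ⟨fr₁, ω, 1, 1, one_pos, hω, Or.inl rfl, hscrew⟩, ?_, ?_⟩
    · refine hexp (isSO13_so13Matrix 0 0 0 ω 0 0) (v := ![-1, -1, 0, 0]) ?_ hscrew.1
      rw [one_smul, lightlikeScrewGenerator_eq]
      ext i j
      fin_cases i <;> fin_cases j <;> simp [augmented, so13Matrix]
    · intro fr F w hF hFG
      obtain ⟨F₁, v₁, hF₁, hFG₁, hI₁, h0⟩ := hFG.exp_conj hF fr₁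
      have hE := exp_augmented F₁ v₁ ((hasMatrixForm_iff.1 hFG₁).trans (hasMatrixForm_iff.1 hG).symm)
      obtain ⟨hp, hz, σ, hσ, hc, hs⟩ := so13_of_exp_eq_rotationMatrix hF₁ hAB hE
      rw [hI₁] at hp hz hc hs
      refine ⟨hp, fun _ => ⟨σ, hσ, fun lam ω hl _ hlo => ?_⟩, fun h => absurd (h0.1 (hz h.1)) h.2⟩
      obtain ⟨fr₂, h₂⟩ := hG.rescale_rotation hl
      rw [← hlo, mul_comm] at hc hs
      -- The prescribed angle is `Real.sqrt (2 * invariantI1 F)`. If the actual rotation has the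
      -- opposite sense, the half turn corrects it and gives ε = -1.
      rcases hσ with rfl | rfl
      · refine ⟨fr₂, isLightlikeScrewForm_of_hasMatrixForm ?_⟩
        simpa [hc, hs] using h₂
      · obtain ⟨fr₃, h₃⟩ := h₂.flip_rotation
        refine ⟨fr₃, isLightlikeScrewForm_of_hasMatrixForm ?_⟩
        simpa [hc, hs] using h₃
  · have hnull : IsNullRotationForm fr₁ P hP (-a) 1 := by
      apply isNullRotationForm_of_hasMatrixForm
      simpa using hG
    refine ⟨Or.inr ⟨fr₁, -a, 1, one_pos, neg_ne_zero.2 ha, hnull⟩, ?_, ?_⟩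
    · refine hexp (isSO13_so13Matrix 0 a 0 0 0 a) (v := ![-1, -1, 0, 0]) ?_ hnull.1
      rw [one_smul, nullRotationGenerator_eq]
      ext i j
      fin_cases i <;> fin_cases j <;> simp [augmented, so13Matrix]
    · intro fr F w hF hFG
      obtain ⟨F₁, v₁, hF₁, hFG₁, hI₁, h0⟩ := hFG.exp_conj hF fr₁
      have hE := exp_augmented F₁ v₁ ((hasMatrixForm_iff.1 hFG₁).trans (hasMatrixForm_iff.1 hG).symm)
      obtain ⟨hz, hne⟩ := so13_of_exp_eq_nullRotationMatrix hF₁ ha hE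
      rw [hI₁] at hz
      refine ⟨hz.ge, fun h => ?_, fun _ lam κ hl hκ => ?_⟩
      · rcases h with h | h
        · exact absurd hz h.ne'
        · exact absurd (h0.2 h) hne
      · obtain ⟨fr₂, h₂⟩ := hG.rescale_nullRotation ha
          (neg_ne_zero.2 (mul_ne_zero hκ hl.ne')) lam
        exact ⟨fr₂, isNullRotationForm_of_hasMatrixForm h₂⟩
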